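/- Let $n\ge 1$ and let $n$ distinct real numbers be given as input in uniformly random order $a=(a_1,\dots,a_n)$. Bubble sort performs passes $i=1,2,\dots$; in the $i$-th pass, for $j=1,2,\dots,n-i$ in turn, it swaps the entries in positions $j$ and $j+1$ if the former is larger than the latter. Let $P_n$ be the number of passes required, that is, the least number of the form $i+1$ with $i\ge 0$ such that the sequence is sorted at the end of the $i$-th pass (for $i=0$: the input itself is sorted). Put $X_n=(n-P_n)/\sqrt n$. Then, as $n\to\infty$, $$\mathbb{E}(X_n^2)=2-4\sqrt{\frac{\pi}{2n}}+\frac5n-\frac{5}{3n}\sqrt{\frac{\pi}{2n}}-\frac{4}{135n^2}\pm\Theta\big(n^{-5/2}\big)$$ and $$\mathbb{V}(X_n)=\frac{4-\pi}{2}-\frac23\sqrt{\frac{\pi}{2n}}+\frac{160-33\pi}{72n}-\frac{107}{540n}\sqrt{\frac{\pi}{2n}}-\frac{1125\pi-1792}{25920n^2}\pm\Theta\big(n^{-5/2}\big).$$ Here $A_n=B_n\pm\Theta(g_n)$ means that $|A_n-B_n|=\Theta(g_n)$, i.e. there are constants $0<c\le C$ with $c\,g_n\le|A_n-B_n|\le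 C\,g_n$ for all sufficiently large $n$. -/

import Mathlib

open Filter Asymptotics MeasureTheory ProbabilityTheory

namespace BubbleSort

section Algorithm

variable {α : Type*} [LinearOrder α] {n : ℕ}

/-- One comparison step on a sequence `a` of length `n` (positions are numbered from `0`):
the entries at positions `j` and `j + 1` are swapped if they are out of order.  Nothing happens
if `j + 1` is not a position. -/
def compareSwap (j : ℕ) (a : Fin n → α) : Fin n → α :=
  if h : j + 1 < n then
    if a ⟨j + 1, h⟩ < a ⟨j, Nat.lt_of_succ_lt h⟩ then
      a ∘ Equiv.swap ⟨j, Nat.lt_of_succ_lt h⟩ ⟨j + 1, h⟩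
    else a
  else a

/-- The sequence after the first `j` comparison steps of a pass that starts from `a`. -/
def partialPass (a : Fin n → α) : ℕ → Fin n → α
  | 0 => a
  | j + 1 => compareSwap j (partialPass a j)

/-- The sequence at the end of the `i`-th pass of bubble sort; the `i`-th pass
(`i = 1, 2, …`) consists of `n - i` comparison steps. -/
def afterPasses (a : Fin n → α) : ℕ → Fin n → α
  | 0 => a
  | i + 1 => partialPass (afterPasses a i) (n - (i + 1))

/-- The number of passes required to bubble sort `a`: the minimum of the numbers `i + 1` such that
`a` is sorted at the end of the `i`-th pass.  (The last pass counted is the one that finds nothing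
to swap; a sorted sequence requires one pass.) -/
noncomputable def numPasses (a : Fin n → α) : ℕ :=
  sInf {p : ℕ | ∃ i : ℕ, p = i + 1 ∧ Monotone (afterPasses a i)}

end Algorithm

/-- Every set of permutations is an event. -/
instance permMeasurableSpace (n : ℕ) : MeasurableSpace (Equiv.Perm (Fin n)) := ⊤

/-- The law of a uniformly random permutation of `n` objects. -/
noncomputable def uniformPerm (n : ℕ) : Measure (Equiv.Perm (Fin n)) :=
  uniformOn Set.univ

/-- The normalised number of passes `(n - P) / √n`, where `P` is the number of passes required to
bubble sort the numbers `x 0, …, x (n - 1)` when they are presented in the order given by `σ`. -/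
noncomputable def normalizedPasses {n : ℕ} (x : Fin n → ℝ) (σ : Equiv.Perm (Fin n)) : ℝ :=
  ((n : ℝ) - (numPasses (x ∘ σ) : ℝ)) / √(n : ℝ)

end BubbleSort

/-! A pass carries the running maximum along and shifts every other entry one place left. For a
threshold `v`, the number of entries above `v` in the first `k` places thus becomes the number in
the first `k + 1` places minus one, truncated at zero. Iterating, `i` passes sort the input exactly
when every entry has at most `i` larger entries to its left (`monotone_afterPasses_iff`). These
counts form an inversion table with independent coordinates, so `∏ min (p + 1) (l + 1)` orders need
at most `p + 1` passes, and `n - P ≥ d` has probability `(n - d)^d / (n (n - 1) ⋯ (n - d + 1))`,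
which is `tailProb n d`.

Summation by parts reduces both moments to `∑ tailProb` and `∑ d * tailProb`. With `h = n^(-1/2)`
and `x = d h`, `tailProb n d` is `exp (-x²/2)` times a polynomial in `h` with coefficients
polynomial in `x`, up to `h^6` times a power of `1 + x` times the same Gaussian
(`exists_abs_tailProb_sub_le`). Euler–Maclaurin summation (`abs_tsum_polyGauss_sub_le`) then yields
half-line Gaussian moments and boundary terms at `0`, with error `O(h^5)`. The prefactors in the
moments contribute at least one more `h`, so their `h^5` coefficients are exact. After subtracting
the claimed terms these are `23/96 √(π/2)` and `2291/181440 √(π/2)`; both are nonzero, whence the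
two-sided order. -/

namespace BubbleSort

/-! ### Prefix counts under bubble sort passes. -/

section Combinatorics

variable {α : Type*} [LinearOrder α] {n : ℕ}

/-- The number of entries greater than `v` among the first `k` entries of `a`. -/
def countAbove (a : Fin n → α) (k : ℕ) (v : α) : ℕ :=
  (Finset.univ.filter fun l : Fin n => l.val < k ∧ v < a l).card

lemma countAbove_zero (a : Fin n → α) (v : α) : countAbove a 0 v = 0 := by
  simp [countAbove]

lemma countAbove_succ (a : Fin n → α) {k : ℕ} (hk : k < n) (v : α) :
    countAbove a (k + 1) v = countAbove a k v + if v < a ⟨k, hk⟩ then 1 else 0 := by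
  unfold countAbove
  split_ifs with h
  · rw [← Finset.card_insert_of_notMem (a := (⟨k, hk⟩ : Fin n)) (by simp)]
    congr 1
    ext l
    simp only [Finset.mem_filter, Finset.mem_univ, true_and, Finset.mem_insert, Fin.ext_iff]
    constructor
    · rintro ⟨h1, h2⟩
      by_cases h3 : l.val = k
      · exact Or.inl h3
      · exact Or.inr ⟨by omega, h2⟩
    · rintro (h1 | ⟨h1, h2⟩)
      · have : l = ⟨k, hk⟩ := Fin.ext h1
        subst this
        exact ⟨by simp, h⟩
      · exact ⟨by omega, h2⟩
  · rw [add_zero]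
    congr 1
    ext l
    simp only [Finset.mem_filter, Finset.mem_univ, true_and]
    constructor
    · rintro ⟨h1, h2⟩
      refine ⟨?_, h2⟩
      by_contra h3
      have : l = ⟨k, hk⟩ := Fin.ext (by simp; omega)
      subst this
      exact h h2
    · rintro ⟨h1, h2⟩
      exact ⟨by omega, h2⟩

lemma countAbove_le_succ (a : Fin n → α) {k : ℕ} (hk : k < n) (v : α) :
    countAbove a k v ≤ countAbove a (k + 1) v ∧
      countAbove a (k + 1) v ≤ countAbove a k v + 1 := by
  rw [countAbove_succ a hk]
  split_ifs <;> omega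

lemma countAbove_anti (a : Fin n → α) (k : ℕ) {v w : α} (h : v ≤ w) :
    countAbove a k w ≤ countAbove a k v := by
  refine Finset.card_le_card fun l => ?_
  simp only [Finset.mem_filter, Finset.mem_univ, true_and]
  exact fun h1 => ⟨h1.1, h.trans_lt h1.2⟩

lemma countAbove_congr {a b : Fin n → α} {k : ℕ} (h : ∀ l : Fin n, l.val < k → a l = b l) (v : α) :
    countAbove a k v = countAbove b k v := by
  unfold countAbove
  congr 1
  ext l
  simp only [Finset.mem_filter, Finset.mem_univ, true_and]
  constructor
  · rintro ⟨h1, h2⟩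
    exact ⟨h1, h l h1 ▸ h2⟩
  · rintro ⟨h1, h2⟩
    exact ⟨h1, (h l h1).symm ▸ h2⟩

/-- Only the prefix separating positions `j` and `j + 1` is affected: it now ends in the smaller of
the two entries, which exceeds `v` exactly when both do. The truncated subtraction is the indicator
of that event. -/
lemma countAbove_compareSwap (a : Fin n → α) {j : ℕ} (hj : j + 1 < n) {k : ℕ} (hk : k ≤ n) (v : α) :
    countAbove (compareSwap j a) k v =
      if k = j + 1 then countAbove a j v + (countAbove a (j + 2) v - countAbove a j v - 1)
      else countAbove a k v := by
  have hj0 : j < n := by omega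
  have hother : ∀ l : Fin n, l.val ≠ j → l.val ≠ j + 1 → compareSwap j a l = a l := by
    intro l h1 h2
    unfold compareSwap
    rw [dif_pos hj]
    split_ifs
    · simp only [Function.comp]
      rw [Equiv.swap_apply_of_ne_of_ne]
      · simpa [Fin.ext_iff] using h1
      · simpa [Fin.ext_iff] using h2
    · rfl
  have hfst : compareSwap j a ⟨j, hj0⟩ = min (a ⟨j, hj0⟩) (a ⟨j + 1, hj⟩) := by
    unfold compareSwap
    rw [dif_pos hj]
    split_ifs with h
    · simp [h.le]
    · simp [not_lt.1 h]
  have hsnd : compareSwap j a ⟨j + 1, hj⟩ = max (a ⟨j, hj0⟩) (a ⟨j + 1, hj⟩) := by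
    unfold compareSwap
    rw [dif_pos hj]
    split_ifs with h
    · simp [h.le]
    · simp [not_lt.1 h]
  have hlow : ∀ k ≤ j, countAbove (compareSwap j a) k v = countAbove a k v := by
    intro k hk
    exact countAbove_congr (fun l hl => hother l (by omega) (by omega)) v
  have e1 := countAbove_succ a hj0 v
  have e2 : countAbove a (j + 2) v = _ := countAbove_succ a hj v
  have e1' := countAbove_succ (compareSwap j a) hj0 v
  have e2' : countAbove (compareSwap j a) (j + 2) v = _ :=
    countAbove_succ (compareSwap j a) hj v
  rw [hfst, hlow j le_rfl] at e1'
  rw [hsnd] at e2'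
  simp only [lt_min_iff, lt_max_iff] at e1' e2'
  have hhigh : ∀ k, j + 2 ≤ k → k ≤ n →
      countAbove (compareSwap j a) k v = countAbove a k v := by
    intro k hk
    induction k, hk using Nat.le_induction with
    | base =>
      intro _
      by_cases h1 : v < a ⟨j, hj0⟩ <;> by_cases h2 : v < a ⟨j + 1, hj⟩ <;>
        simp [h1, h2] at e1 e2 e1' e2' <;> omega
    | succ k hk ih =>
      intro hkn
      rw [countAbove_succ _ (by omega), countAbove_succ _ (by omega), ih (by omega),
        hother _ (by simp; omega) (by simp; omega)]
  split_ifs with hkj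
  · subst hkj
    by_cases h1 : v < a ⟨j, hj0⟩ <;> by_cases h2 : v < a ⟨j + 1, hj⟩ <;>
      simp [h1, h2] at e1 e2 e1' <;> omega
  · rcases Nat.lt_or_ge k (j + 1) with h | h
    · exact hlow k (by omega)
    · exact hhigh k (by omega) hk

/-- A prefix already traversed holds the old prefix of one more entry, with its maximum carried off.
If anything there exceeds `v`, the maximum does; truncation covers the other case. -/
lemma countAbove_partialPass (a : Fin n → α) (j : ℕ) (hj : j + 1 ≤ n) (k : ℕ) (hk : k ≤ n) (v : α) :
    countAbove (partialPass a j) k v =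
      if k ≤ j then countAbove a (k + 1) v - 1 else countAbove a k v := by
  induction j generalizing k with
  | zero =>
    simp only [partialPass]
    split_ifs with h
    · have : k = 0 := by omega
      subst this
      have := countAbove_le_succ a (k := 0) (by omega) v
      rw [countAbove_zero] at *
      omega
    · rfl
  | succ j ih =>
    simp only [partialPass]
    rw [countAbove_compareSwap _ (by omega) hk, ih (by omega) j (by omega),
      ih (by omega) (j + 2) (by omega), ih (by omega) k hk]
    have h1 := countAbove_le_succ a (k := j) (by omega) v
    have h2 := countAbove_le_succ a (k := j + 1) (by omega) v
    by_cases hkj : k = j + 1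
    · subst hkj
      simp
      simp only [Nat.add_assoc, Nat.reduceAdd] at h1 h2 ⊢
      omega
    · rw [if_neg hkj]
      by_cases h : k ≤ j
      · rw [if_pos h, if_pos (by omega)]
      · rw [if_neg h, if_neg (by omega)]

/-- The prefix gains one place and loses one large entry per pass until it would run past `n`. From
then on the last `n - k` places hold the largest entries for good, which is the second branch. -/
lemma countAbove_afterPasses (a : Fin n → α) (i : ℕ) (hi : i ≤ n) (k : ℕ) (hk : k ≤ n) (v : α) :
    countAbove (afterPasses a i) k v =
      if k + i ≤ n then countAbove a (k + i) v - i else countAbove a n v - (n - k) := by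
  induction i generalizing k with
  | zero => simp [afterPasses, hk]
  | succ i ih =>
    simp only [afterPasses]
    rw [countAbove_partialPass _ _ (by omega) k hk]
    by_cases h : k + (i + 1) ≤ n
    · rw [if_pos (by omega), ih (by omega) _ (by omega), if_pos (by omega), if_pos h,
        show k + 1 + i = k + (i + 1) by ring]
      omega
    · rw [if_neg (by omega), ih (by omega) _ (by omega), if_neg h]
      split_ifs with h2
      · have h3 : k + i = n := by omega
        rw [h3]
        congr 1
        omega
      · rfl

lemma monotone_iff_countAbove (a : Fin n → α) :
    Monotone a ↔ ∀ v : α, ∀ k < n, countAbove a (k + 1) v = countAbove a k v →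
      countAbove a k v = 0 := by
  constructor
  · intro hm v k hk h
    rw [countAbove_succ a hk] at h
    have hv : ¬ v < a ⟨k, hk⟩ := by
      intro h'
      rw [if_pos h'] at h
      omega
    unfold countAbove
    rw [Finset.card_eq_zero, Finset.filter_eq_empty_iff]
    rintro l - ⟨h1, h2⟩
    exact hv (h2.trans_le (hm (Fin.le_def.2 h1.le)))
  · intro h p q hpq
    by_contra hlt
    rw [not_le] at hlt
    have := h (a q) q.val q.isLt (by rw [countAbove_succ a q.isLt]; simp)
    unfold countAbove at this
    rw [Finset.card_eq_zero, Finset.filter_eq_empty_iff] at this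
    refine this (Finset.mem_univ p) ⟨?_, hlt⟩
    rcases hpq.lt_or_eq with h' | h'
    · exact h'
    · subst h'
      exact absurd hlt (lt_irrefl _)

lemma countAbove_le (a : Fin n → α) {k : ℕ} (hk : k ≤ n) (v : α) : countAbove a k v ≤ k := by
  induction k with
  | zero => simp [countAbove_zero]
  | succ k ih =>
    have := countAbove_le_succ a (k := k) (by omega) v
    have := ih (by omega)
    omega

lemma monotone_afterPasses_iff (a : Fin n → α) {i : ℕ} (hi : i ≤ n) :
    Monotone (afterPasses a i) ↔ ∀ l : Fin n, countAbove a l (a l) ≤ i := by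
  rw [monotone_iff_countAbove]
  constructor
  · intro h l
    by_cases hl : l.val ≤ i
    · exact (countAbove_le a l.isLt.le _).trans hl
    · have hln := l.isLt
      -- With threshold `a l`, the entry at `l` is not counted, so after `i` passes the count is
      -- stationary at `l - i` and must vanish there.
      have h1 := h (a l) (l - i) (by omega)
      rw [countAbove_afterPasses a i hi _ (by omega), countAbove_afterPasses a i hi _ (by omega),
        if_pos (by omega), if_pos (by omega), show l.val - i + 1 + i = l + 1 by omega,
        show l.val - i + i = l by omega, countAbove_succ a hln] at h1
      simp only [Fin.eta, lt_self_iff_false, if_false, add_zero, forall_true_left] at h1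
      omega
  · intro h v k hk
    rw [countAbove_afterPasses a i hi _ (by omega), countAbove_afterPasses a i hi _ (by omega)]
    by_cases h1 : k + 1 + i ≤ n
    · rw [if_pos h1, if_pos (by omega), show k + 1 + i = k + i + 1 by ring,
        countAbove_succ a (k := k + i) (by omega)]
      split_ifs with h2
      · omega
      · intro _
        have h3 := h ⟨k + i, by omega⟩
        have h4 := countAbove_anti a (k + i) (not_lt.1 h2)
        simp only at h3
        omega
    · rw [if_neg h1]
      split_ifs with h2
      · have h3 : k + i = n := by omega
        rw [h3]
        omega
      · omega

lemma numPasses_le_succ_iff (a : Fin n → α) (p : ℕ) :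
    numPasses a ≤ p + 1 ↔ ∀ l : Fin n, countAbove a l (a l) ≤ p := by
  have hn : Monotone (afterPasses a n) :=
    (monotone_afterPasses_iff a le_rfl).2 fun l =>
      (countAbove_le a l.isLt.le _).trans l.isLt.le
  have hle : numPasses a ≤ n + 1 := Nat.sInf_le ⟨n, rfl, hn⟩
  obtain ⟨i, hi, hmi⟩ := Nat.sInf_mem (s := {p : ℕ | ∃ i : ℕ, p = i + 1 ∧
    Monotone (afterPasses a i)}) ⟨_, n, rfl, hn⟩
  change numPasses a = i + 1 at hi
  constructor
  · intro h l
    exact ((monotone_afterPasses_iff a (by omega)).1 hmi l).trans (by omega)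
  · intro h
    rcases le_total n p with hp | hp
    · omega
    · exact Nat.sInf_le ⟨p, rfl, (monotone_afterPasses_iff a hp).2 h⟩

lemma one_le_numPasses (a : Fin n → α) : 1 ≤ numPasses a := by
  have hn : Monotone (afterPasses a n) :=
    (monotone_afterPasses_iff a le_rfl).2 fun l =>
      (countAbove_le a l.isLt.le _).trans l.isLt.le
  obtain ⟨i, hi, hmi⟩ := Nat.sInf_mem (s := {p : ℕ | ∃ i : ℕ, p = i + 1 ∧
    Monotone (afterPasses a i)}) ⟨_, n, rfl, hn⟩
  change numPasses a = i + 1 at hi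
  omega

lemma numPasses_le (a : Fin n → α) (hn : 1 ≤ n) : numPasses a ≤ n := by
  obtain ⟨m, rfl⟩ : ∃ m, n = m + 1 := ⟨n - 1, by omega⟩
  exact (numPasses_le_succ_iff a m).2 fun l => (countAbove_le a l.isLt.le _).trans (by omega)

/-! ### Counting permutations by inversion tables. -/

/-- The number of entries of `a` that stand to the right of position `l` and are greater than the
entry there. -/
def greaterAfter (a : Fin n → α) (l : Fin n) : ℕ :=
  (Finset.univ.filter fun j : Fin n => l < j ∧ a l < a j).card

/-- Reversal moves the larger entries from the left to the right, so that the count at the first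
position, the one split off by `Equiv.Perm.decomposeFin`, depends on the value there alone. -/
lemma countAbove_comp_rev (a : Fin n → α) (l : Fin n) :
    countAbove (a ∘ Fin.rev) l ((a ∘ Fin.rev) l) = greaterAfter a (Fin.rev l) := by
  unfold countAbove greaterAfter
  refine Finset.card_bij (fun j _ => Fin.rev j) ?_ ?_ ?_
  · intro j
    simp only [Finset.mem_filter, Finset.mem_univ, true_and, Function.comp, Fin.rev_lt_rev]
    exact fun h => ⟨Fin.lt_def.2 h.1, h.2⟩
  · intro j _ k _ h
    exact Fin.rev_injective h
  · intro j hj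
    refine ⟨Fin.rev j, ?_, Fin.rev_rev j⟩
    simp only [Finset.mem_filter, Finset.mem_univ, true_and, Function.comp, Fin.rev_rev] at hj ⊢
    refine ⟨Fin.lt_def.1 ?_, hj.2⟩
    have := Fin.rev_lt_rev.2 hj.1
    rwa [Fin.rev_rev] at this

/-- Ranking distinct values from the top is an injection of `Fin m` into itself, hence a bijection,
so every rank below `p` and `m` occurs once. -/
lemma card_filter_card_lt {m p : ℕ} {x : Fin m → α} (hx : Function.Injective x) :
    (Finset.univ.filter fun v : Fin m =>
      (Finset.univ.filter fun j : Fin m => x v < x j).card < p).card = min p m := by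
  have hlt : ∀ v : Fin m, (Finset.univ.filter fun j : Fin m => x v < x j).card < m := by
    intro v
    have : (Finset.univ.filter fun j : Fin m => x v < x j).card <
        (Finset.univ : Finset (Fin m)).card :=
      Finset.card_lt_card (Finset.filter_ssubset.2 ⟨v, Finset.mem_univ _, lt_irrefl _⟩)
    simpa using this
  let r : Fin m → Fin m := fun v => ⟨_, hlt v⟩
  have hmono : ∀ v w : Fin m, x v < x w → r w < r v := by
    intro v w h
    suffices hc : (Finset.univ.filter fun j : Fin m => x w < x j) ⊂
        Finset.univ.filter fun j : Fin m => x v < x j from Finset.card_lt_card hc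
    rw [Finset.ssubset_iff_of_subset]
    · exact ⟨w, by simp [h], by simp⟩
    · intro j
      simp only [Finset.mem_filter, Finset.mem_univ, true_and]
      exact fun h1 => h.trans h1
  have hinj : Function.Injective r := by
    intro v w h
    rcases lt_trichotomy (x v) (x w) with h1 | h1 | h1
    · exact absurd h (hmono _ _ h1).ne'
    · exact hx h1
    · exact absurd h (hmono _ _ h1).ne
  have hbij : Function.Bijective r := Finite.injective_iff_bijective.1 hinj
  have h1 : (Finset.univ.filter fun v : Fin m => (r v).val < p).card =
      (Finset.univ.filter fun v : Fin m => v.val < p).card := by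
    refine Finset.card_bijective r hbij ?_
    intro v
    simp
  have h2 : (Finset.univ.filter fun v : Fin m => v.val < p).card = min p m := by
    rw [← Finset.card_map Fin.valEmbedding]
    have : (Finset.univ.filter fun v : Fin m => v.val < p).map Fin.valEmbedding =
        Finset.range (min p m) := by
      ext k
      simp only [Finset.mem_map, Finset.mem_filter, Finset.mem_univ, true_and,
        Fin.valEmbedding_apply, Finset.mem_range, lt_min_iff]
      constructor
      · rintro ⟨v, h1, rfl⟩
        exact ⟨h1, v.isLt⟩
      · rintro ⟨h1, h2⟩
        exact ⟨⟨k, h2⟩, h1, rfl⟩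
    rw [this, Finset.card_range]
  exact h1.trans h2

lemma greaterAfter_succ {m : ℕ} (a : Fin (m + 1) → α) (l : Fin m) :
    greaterAfter a l.succ = greaterAfter (a ∘ Fin.succ) l := by
  unfold greaterAfter
  symm
  refine Finset.card_bij (fun j _ => Fin.succ j) ?_ ?_ ?_
  · intro j
    simp
  · intro j _ k _ h
    exact Fin.succ_injective _ h
  · intro j hj
    simp only [Finset.mem_filter, Finset.mem_univ, true_and] at hj
    obtain ⟨i, rfl⟩ := Fin.exists_succ_eq.2 (Fin.ne_zero_of_lt hj.1)
    exact ⟨i, by simpa using hj, rfl⟩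

lemma greaterAfter_zero {m : ℕ} (x : Fin (m + 1) → α) (σ : Equiv.Perm (Fin (m + 1))) :
    greaterAfter (x ∘ σ) 0 =
      (Finset.univ.filter fun j : Fin (m + 1) => x (σ 0) < x j).card := by
  unfold greaterAfter
  refine Finset.card_bij (fun j _ => σ j) ?_ ?_ ?_
  · intro j
    simp
  · intro j _ k _ h
    exact σ.injective h
  · intro j hj
    refine ⟨σ.symm j, ?_, by simp⟩
    simp only [Finset.mem_filter, Finset.mem_univ, true_and, Function.comp,
      Equiv.apply_symm_apply] at hj ⊢
    refine ⟨Fin.pos_iff_ne_zero.2 ?_, hj⟩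
    intro h
    rw [← h] at hj
    simp at hj

/-- Choose the first entry, then arrange the rest. The first condition involves only the rank of the
chosen value, with `min p (m + 1)` admissible choices; the others concern an arbitrary arrangement
of the remaining `m` distinct values, which is why `x` is generalized in the induction. -/
lemma card_perm_greaterAfter_lt (p : ℕ) :
    ∀ (m : ℕ) (x : Fin m → α), Function.Injective x →
      (Finset.univ.filter fun σ : Equiv.Perm (Fin m) =>
        ∀ l, greaterAfter (x ∘ σ) l < p).card = ∏ l ∈ Finset.range m, min p (l + 1) := by
  intro m
  induction m with
  | zero =>
    intro x _
    simp
  | succ m ih =>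
    intro x hx
    let y : Fin (m + 1) → Fin m → α := fun v => x ∘ Equiv.swap 0 v ∘ Fin.succ
    have hy : ∀ v, Function.Injective (y v) := fun v =>
      hx.comp ((Equiv.swap 0 v).injective.comp (Fin.succ_injective _))
    have key : (Finset.univ.filter fun σ : Equiv.Perm (Fin (m + 1)) =>
        ∀ l, greaterAfter (x ∘ σ) l < p).card =
        ((Finset.univ.filter fun v : Fin (m + 1) =>
          (Finset.univ.filter fun j : Fin (m + 1) => x v < x j).card < p).sigma fun v =>
          Finset.univ.filter fun e : Equiv.Perm (Fin m) =>
            ∀ l, greaterAfter (y v ∘ e) l < p).card := by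
      symm
      refine Finset.card_bij (fun s _ => Equiv.Perm.decomposeFin.symm (s.1, s.2)) ?_ ?_ ?_
      · rintro ⟨v, e⟩ hs
        simp only [Finset.mem_sigma, Finset.mem_filter, Finset.mem_univ, true_and] at hs ⊢
        intro l
        refine Fin.cases ?_ (fun l => ?_) l
        · rw [greaterAfter_zero, Equiv.Perm.decomposeFin_symm_apply_zero]
          exact hs.1
        · rw [greaterAfter_succ]
          convert hs.2 l using 2
          ext i
          simp [y]
      · rintro ⟨v, e⟩ _ ⟨v', e'⟩ _ h
        have := Equiv.Perm.decomposeFin.symm.injective h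
        simp only [Prod.mk.injEq] at this
        obtain ⟨rfl, rfl⟩ := this
        rfl
      · intro σ hσ
        obtain ⟨⟨v, e⟩, rfl⟩ := Equiv.Perm.decomposeFin.symm.surjective σ
        refine ⟨⟨v, e⟩, ?_, rfl⟩
        simp only [Finset.mem_sigma, Finset.mem_filter, Finset.mem_univ, true_and] at hσ ⊢
        constructor
        · have := hσ 0
          rwa [greaterAfter_zero, Equiv.Perm.decomposeFin_symm_apply_zero] at this
        · intro l
          have := hσ l.succ
          rw [greaterAfter_succ] at this
          convert this using 2
          ext i
          simp [y]
    rw [key, Finset.card_sigma, Finset.sum_congr rfl fun v _ => ih (y v) (hy v),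
      Finset.sum_const, card_filter_card_lt hx, Finset.prod_range_succ, smul_eq_mul, mul_comm]

lemma card_perm_numPasses_le {x : Fin n → α} (hx : Function.Injective x) (p : ℕ) :
    (Finset.univ.filter fun σ : Equiv.Perm (Fin n) => numPasses (x ∘ σ) ≤ p + 1).card =
      ∏ l ∈ Finset.range n, min (p + 1) (l + 1) := by
  rw [← card_perm_greaterAfter_lt (p + 1) n x hx]
  refine Finset.card_bijective (fun σ : Equiv.Perm (Fin n) => σ * Fin.revPerm)
    (Group.mulRight_bijective _) ?_
  intro σ
  simp only [Finset.mem_filter, Finset.mem_univ, true_and]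
  rw [numPasses_le_succ_iff]
  have h : x ∘ σ = (x ∘ (σ * Fin.revPerm : Equiv.Perm (Fin n))) ∘ Fin.rev := by
    ext l
    simp
  constructor
  · intro h1 l
    have h2 := h1 (Fin.rev l)
    rw [h, countAbove_comp_rev, Fin.rev_rev] at h2
    omega
  · intro h1 l
    have h2 := h1 (Fin.rev l)
    rw [h, countAbove_comp_rev]
    omega

end Combinatorics

/-! ### The law of the number of passes and its moments. -/

section Distribution

variable {n : ℕ}

/-- The probability that bubble sort requires at most `n - d` passes. -/
noncomputable def tailProb (n d : ℕ) : ℝ := ((n - d : ℕ) : ℝ) ^ d / (n.descFactorial d : ℝ)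

lemma card_perm_numPasses_eq {x : Fin n → ℝ} (hx : Function.Injective x) {d : ℕ} (hn : 1 ≤ n)
    (hd : d ≤ n) :
    ((Finset.univ.filter fun σ : Equiv.Perm (Fin n) => d ≤ n - numPasses (x ∘ σ)).card : ℝ) =
      n.factorial * tailProb n d := by
  rcases hd.lt_or_eq with hd | rfl
  · have h1 : (Finset.univ.filter fun σ : Equiv.Perm (Fin n) => d ≤ n - numPasses (x ∘ σ)) =
        Finset.univ.filter fun σ : Equiv.Perm (Fin n) => numPasses (x ∘ σ) ≤ (n - d - 1) + 1 := by
      ext σ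
      have := numPasses_le (x ∘ σ) hn
      simp only [Finset.mem_filter, Finset.mem_univ, true_and]
      omega
    -- The first `n - d` factors are `l + 1`; the last `d` are capped at `n - d`.
    have h2 : ∏ l ∈ Finset.range n, min (n - d - 1 + 1) (l + 1) =
        (n - d).factorial * (n - d) ^ d := by
      obtain ⟨m, rfl⟩ : ∃ m, n = m + d := ⟨n - d, by omega⟩
      rw [Finset.prod_range_add, ← Finset.prod_range_add_one_eq_factorial,
        Nat.add_sub_cancel]
      congr 1
      · refine Finset.prod_congr rfl fun l hl => ?_
        have := Finset.mem_range.1 hl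
        omega
      · rw [Finset.prod_congr rfl (g := fun _ => m) fun l _ => by omega]
        simp
    rw [h1, card_perm_numPasses_le hx, h2, ← Nat.factorial_mul_descFactorial hd.le, tailProb]
    have : (n.descFactorial d : ℝ) ≠ 0 := by
      exact_mod_cast (Nat.pos_iff_ne_zero.1 (Nat.descFactorial_pos.2 hd.le))
    push_cast
    field_simp
  -- At `d = n` both sides vanish: at least one pass is always counted, and `0 ^ n = 0` as `n ≥ 1`.
  · have : (Finset.univ.filter fun σ : Equiv.Perm (Fin d) => d ≤ d - numPasses (x ∘ σ)) = ∅ := by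
      rw [Finset.filter_eq_empty_iff]
      intro σ _
      have := one_le_numPasses (x ∘ σ)
      omega
    rw [this, tailProb]
    simp [Nat.pos_iff_ne_zero.1 hn]

instance (n : ℕ) : IsProbabilityMeasure (uniformPerm n) :=
  isProbabilityMeasure_uniformOn Set.finite_univ Set.univ_nonempty

instance (n : ℕ) : MeasurableSingletonClass (Equiv.Perm (Fin n)) := ⟨fun _ => trivial⟩

lemma integral_uniformPerm (f : Equiv.Perm (Fin n) → ℝ) :
    ∫ σ, f σ ∂(uniformPerm n) = (∑ σ, f σ) / n.factorial := by
  rw [integral_fintype (Integrable.of_finite)]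
  have h : ∀ σ : Equiv.Perm (Fin n), (uniformPerm n).real {σ} = (n.factorial : ℝ)⁻¹ := by
    intro σ
    rw [uniformPerm, Measure.real, uniformOn_univ]
    simp [Fintype.card_perm]
  simp_rw [h, smul_eq_mul, ← Finset.mul_sum]
  ring

lemma sum_range_ite_le {D n : ℕ} (hD : D ≤ n) (g : ℕ → ℝ) :
    ∑ d ∈ Finset.range n, (if d + 1 ≤ D then g d else 0) = ∑ d ∈ Finset.range D, g d := by
  rw [← Finset.sum_filter]
  congr 1
  ext d
  simp only [Finset.mem_filter, Finset.mem_range]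
  omega

/-- The discrete layer-cake formula: exchanging the sums turns each `g d` into a weight on a tail
probability. -/
lemma integral_sum_range_passes {x : Fin n → ℝ} (hx : Function.Injective x) (hn : 1 ≤ n)
    (g : ℕ → ℝ) :
    ∫ σ : Equiv.Perm (Fin n), ∑ d ∈ Finset.range (n - numPasses (x ∘ σ)), g d ∂(uniformPerm n) =
      ∑ d ∈ Finset.range n, g d * tailProb n (d + 1) := by
  rw [integral_uniformPerm]
  simp_rw [← fun σ : Equiv.Perm (Fin n) =>
    sum_range_ite_le (D := n - numPasses (x ∘ σ)) (n := n) (by omega) g]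
  rw [Finset.sum_comm, Finset.sum_div]
  refine Finset.sum_congr rfl fun d hd => ?_
  have hd := Finset.mem_range.1 hd
  rw [← Finset.sum_filter, Finset.sum_const, nsmul_eq_mul,
    card_perm_numPasses_eq hx hn (by omega)]
  have : (n.factorial : ℝ) ≠ 0 := by exact_mod_cast n.factorial_ne_zero
  field_simp

lemma normalizedPasses_eq {x : Fin n → ℝ} (hn : 1 ≤ n) (σ : Equiv.Perm (Fin n)) :
    normalizedPasses x σ = (∑ _d ∈ Finset.range (n - numPasses (x ∘ σ)), (1 : ℝ)) / √n := by
  rw [normalizedPasses, Finset.sum_const, nsmul_eq_mul, mul_one, Finset.card_range,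
    Nat.cast_sub (numPasses_le _ hn)]

lemma sum_range_odd (D : ℕ) : ∑ d ∈ Finset.range D, (2 * (d : ℝ) + 1) = (D : ℝ) ^ 2 := by
  induction D with
  | zero => simp
  | succ D ih =>
    rw [Finset.sum_range_succ, ih]
    push_cast
    ring

lemma normalizedPasses_sq_eq {x : Fin n → ℝ} (hn : 1 ≤ n) (σ : Equiv.Perm (Fin n)) :
    normalizedPasses x σ ^ 2 =
      (∑ d ∈ Finset.range (n - numPasses (x ∘ σ)), (2 * (d : ℝ) + 1)) / n := by
  rw [normalizedPasses, sum_range_odd, Nat.cast_sub (numPasses_le _ hn), div_pow,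
    Real.sq_sqrt (Nat.cast_nonneg n)]

theorem integral_normalizedPasses {x : Fin n → ℝ} (hx : Function.Injective x) (hn : 1 ≤ n) :
    ∫ σ, normalizedPasses x σ ∂(uniformPerm n) =
      (∑ d ∈ Finset.range n, tailProb n (d + 1)) / √n := by
  simp_rw [normalizedPasses_eq hn]
  rw [integral_div, integral_sum_range_passes hx hn]
  simp

theorem integral_normalizedPasses_sq {x : Fin n → ℝ} (hx : Function.Injective x) (hn : 1 ≤ n) :
    ∫ σ, normalizedPasses x σ ^ 2 ∂(uniformPerm n) =
      (∑ d ∈ Finset.range n, (2 * (d : ℝ) + 1) * tailProb n (d + 1)) / n := by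
  simp_rw [normalizedPasses_sq_eq hn]
  rw [integral_div, integral_sum_range_passes hx hn]

theorem variance_normalizedPasses (x : Fin n → ℝ) :
    variance (normalizedPasses x) (uniformPerm n) =
      ∫ σ, normalizedPasses x σ ^ 2 ∂(uniformPerm n) -
        (∫ σ, normalizedPasses x σ ∂(uniformPerm n)) ^ 2 := by
  rw [variance_eq_sub (MemLp.of_discrete)]
  rfl

end Distribution
-- Euler–Maclaurin summation for polynomials times a Gaussian.
section GaussianSums

open Polynomial

/-- The function `p(x) exp (-x² / 2)`. -/
noncomputable def polyGauss (p : ℝ[X]) (x : ℝ) : ℝ := p.eval x * Real.exp (-x ^ 2 / 2)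

/-- The polynomial factor of the derivative of `p(x) exp (-x² / 2)`. -/
noncomputable def gaussDeriv (p : ℝ[X]) : ℝ[X] := derivative p - X * p

lemma hasDerivAt_polyGauss (p : ℝ[X]) (x : ℝ) :
    HasDerivAt (polyGauss p) (polyGauss (gaussDeriv p) x) x := by
  have h1 : HasDerivAt (fun x : ℝ => -x ^ 2 / 2) (-x) x := by
    have := (hasDerivAt_pow 2 x).fun_neg.div_const 2
    exact this.congr_deriv (by push_cast; ring)
  have h2 := (p.hasDerivAt x).mul h1.exp
  refine h2.congr_deriv ?_
  simp [polyGauss, gaussDeriv]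
  ring

lemma continuous_polyGauss (p : ℝ[X]) : Continuous (polyGauss p) :=
  continuous_iff_continuousAt.2 fun x => (hasDerivAt_polyGauss p x).continuousAt

lemma exists_abs_eval_le (p : ℝ[X]) :
    ∃ C : ℝ, ∃ K : ℕ, 0 ≤ C ∧ ∀ x : ℝ, 0 ≤ x → |p.eval x| ≤ C * (1 + x) ^ K := by
  induction p using Polynomial.induction_on' with
  | add p q hp hq =>
    obtain ⟨C, K, hC, h⟩ := hp
    obtain ⟨C', K', hC', h'⟩ := hq
    refine ⟨C + C', K + K', by positivity, fun x hx => ?_⟩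
    rw [eval_add, add_mul]
    refine (abs_add_le _ _).trans (add_le_add ((h x hx).trans ?_) ((h' x hx).trans ?_))
    · gcongr
      · linarith
      · omega
    · gcongr
      · linarith
      · omega
  | monomial k c =>
    refine ⟨|c|, k, abs_nonneg c, fun x hx => ?_⟩
    rw [eval_monomial, abs_mul, abs_of_nonneg (pow_nonneg hx k)]
    gcongr
    linarith

/-- Trades the Gaussian for `exp (-x)`, whose sums over a grid are geometric. The exponents compare
by `(x - 2)² ≥ 0`. -/
lemma pow_mul_exp_le (K : ℕ) {x : ℝ} (hx : 0 ≤ x) :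
    (1 + x) ^ K * Real.exp (-x ^ 2 / 2) ≤ K.factorial * Real.exp 3 * Real.exp (-x) := by
  have h1 : (1 + x) ^ K ≤ K.factorial * Real.exp (1 + x) := by
    have := Real.pow_div_factorial_le_exp (1 + x) (by linarith) K
    rwa [div_le_iff₀' (by positivity)] at this
  calc (1 + x) ^ K * Real.exp (-x ^ 2 / 2)
      ≤ K.factorial * Real.exp (1 + x) * Real.exp (-x ^ 2 / 2) := by gcongr
    _ = K.factorial * Real.exp (1 + x + -x ^ 2 / 2) := by rw [mul_assoc, ← Real.exp_add]
    _ ≤ K.factorial * Real.exp (3 + -x) := by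
        refine mul_le_mul_of_nonneg_left (Real.exp_le_exp.2 ?_) (by positivity)
        nlinarith [sq_nonneg (x - 2)]
    _ = _ := by rw [Real.exp_add, mul_assoc]

lemma exists_abs_polyGauss_le (p : ℝ[X]) :
    ∃ C : ℝ, 0 ≤ C ∧ ∀ x : ℝ, 0 ≤ x → |polyGauss p x| ≤ C * Real.exp (-x) := by
  obtain ⟨C, K, hC, h⟩ := exists_abs_eval_le p
  refine ⟨C * (K.factorial * Real.exp 3), by positivity, fun x hx => ?_⟩
  rw [polyGauss, abs_mul, Real.abs_exp]
  calc _ ≤ C * (1 + x) ^ K * Real.exp (-x ^ 2 / 2) := by gcongr; exact h x hx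
    _ = C * ((1 + x) ^ K * Real.exp (-x ^ 2 / 2)) := by ring
    _ ≤ C * (K.factorial * Real.exp 3 * Real.exp (-x)) := by
        exact mul_le_mul_of_nonneg_left (pow_mul_exp_le K hx) hC
    _ = _ := by ring

lemma tendsto_polyGauss (p : ℝ[X]) : Tendsto (polyGauss p) atTop (nhds 0) := by
  obtain ⟨C, -, h⟩ := exists_abs_polyGauss_le p
  refine squeeze_zero_norm' (a := fun x => C * Real.exp (-x)) ?_ ?_
  · filter_upwards [eventually_ge_atTop 0] with x hx using h x hx
  · simpa using Real.tendsto_exp_neg_atTop_nhds_zero.const_mul C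

lemma integrableOn_polyGauss (p : ℝ[X]) : IntegrableOn (polyGauss p) (Set.Ioi 0) := by
  obtain ⟨C, -, h⟩ := exists_abs_polyGauss_le p
  have h1 : IntegrableOn (fun x : ℝ => C * Real.exp (-x)) (Set.Ioi 0) :=
    (integrableOn_exp_neg_Ioi 0).const_mul C
  refine h1.mono' (continuous_polyGauss p).aestronglyMeasurable ?_
  filter_upwards [ae_restrict_mem measurableSet_Ioi] with x hx using h x (le_of_lt hx)

/-- The integral of `p(x) exp (-x² / 2)` over the positive half-line. -/
noncomputable def halfMoment (p : ℝ[X]) : ℝ := ∫ x in Set.Ioi 0, polyGauss p x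

lemma halfMoment_add (p q : ℝ[X]) : halfMoment (p + q) = halfMoment p + halfMoment q := by
  rw [halfMoment, halfMoment, halfMoment,
    ← integral_add (integrableOn_polyGauss p) (integrableOn_polyGauss q)]
  simp [polyGauss, add_mul]

lemma halfMoment_C_mul (c : ℝ) (p : ℝ[X]) : halfMoment (C c * p) = c * halfMoment p := by
  rw [halfMoment, halfMoment, ← integral_const_mul]
  simp [polyGauss, mul_assoc]

lemma halfMoment_gaussDeriv (p : ℝ[X]) : halfMoment (gaussDeriv p) = -p.eval 0 := by
  rw [halfMoment, integral_Ioi_of_hasDerivAt_of_tendsto'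
    (fun x _ => hasDerivAt_polyGauss p x) (integrableOn_polyGauss _) (tendsto_polyGauss p)]
  simp [polyGauss]

lemma halfMoment_one : halfMoment 1 = √(Real.pi / 2) := by
  have h : halfMoment 1 = ∫ x in Set.Ioi (0 : ℝ), Real.exp (-(1 / 2) * x ^ 2) := by
    rw [halfMoment]
    congr 1
    ext x
    simp only [polyGauss, eval_one, one_mul]
    congr 1
    ring
  rw [h, integral_gaussian_Ioi, show Real.pi / (1 / 2) = 2 ^ 2 * (Real.pi / 2) by ring,
    Real.sqrt_mul (by positivity), Real.sqrt_sq (by norm_num)]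
  ring

lemma halfMoment_X : halfMoment X = 1 := by
  have h := halfMoment_gaussDeriv 1
  have h2 : gaussDeriv 1 = C (-1) * X := by simp [gaussDeriv]
  rw [h2, halfMoment_C_mul] at h
  simp at h
  linarith

lemma halfMoment_X_pow_add_two (k : ℕ) :
    halfMoment (X ^ (k + 2)) = (k + 1) * halfMoment (X ^ k) := by
  have h := halfMoment_gaussDeriv (X ^ (k + 1))
  have h2 : gaussDeriv (X ^ (k + 1)) = C ((k : ℝ) + 1) * X ^ k + C (-1) * X ^ (k + 2) := by
    simp [gaussDeriv]
    ring
  rw [h2, halfMoment_add, halfMoment_C_mul, halfMoment_C_mul] at h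
  simp at h
  linarith

/-- Taylor's formula with a crude remainder. -/
lemma abs_sub_taylor_le (N : ℕ) : ∀ (g : ℕ → ℝ → ℝ) (x h M : ℝ), 0 ≤ h →
    (∀ k y, HasDerivAt (g k) (g (k + 1) y) y) → (∀ y ∈ Set.Icc x (x + h), |g N y| ≤ M) →
    |g 0 (x + h) - ∑ k ∈ Finset.range N, g k x * h ^ k / k.factorial| ≤ M * h ^ N := by
  induction N with
  | zero =>
    intro g x h M hh _ hb
    simpa using hb (x + h) ⟨by linarith, le_rfl⟩
  | succ N ih =>
    intro g x h M hh hg hb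
    have hM : 0 ≤ M := (abs_nonneg _).trans (hb x ⟨le_rfl, by linarith⟩)
    let r : ℝ → ℝ := fun u =>
      g 0 (x + u) - ∑ k ∈ Finset.range (N + 1), g k x * u ^ k / k.factorial
    have hr : ∀ u ∈ Set.Icc 0 h, HasDerivWithinAt r
        (g 1 (x + u) - ∑ k ∈ Finset.range N, g (k + 1) x * u ^ k / k.factorial)
        (Set.Icc 0 h) u := by
      intro u _
      refine HasDerivAt.hasDerivWithinAt ?_
      refine ((hg 0 (x + u)).comp_const_add x u).sub ?_
      have h1 : HasDerivAt (fun u : ℝ => ∑ k ∈ Finset.range (N + 1), g k x * u ^ k / k.factorial)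
          (∑ k ∈ Finset.range (N + 1), g k x * (k * u ^ (k - 1)) / k.factorial) u := by
        refine HasDerivAt.fun_sum fun k _ => ?_
        exact ((hasDerivAt_pow k u).const_mul (g k x)).div_const _
      refine h1.congr_deriv ?_
      rw [Finset.sum_range_succ']
      simp only [Nat.add_sub_cancel, Nat.cast_zero, zero_mul, mul_zero, zero_div, add_zero]
      refine Finset.sum_congr rfl fun k _ => ?_
      rw [Nat.factorial_succ]
      have : (k.factorial : ℝ) ≠ 0 := by exact_mod_cast k.factorial_ne_zero
      have : (k : ℝ) + 1 ≠ 0 := by positivity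
      push_cast
      field_simp
    -- The derivative of the remainder is the order-`N` remainder of the shifted sequence; the mean
    -- value inequality adds the missing factor `h`.
    have hbound : ∀ u ∈ Set.Ico 0 h,
        ‖g 1 (x + u) - ∑ k ∈ Finset.range N, g (k + 1) x * u ^ k / k.factorial‖ ≤ M * h ^ N := by
      intro u hu
      refine (ih (fun k => g (k + 1)) x u M hu.1 (fun k => hg (k + 1)) ?_).trans ?_
      · exact fun y hy => hb y ⟨hy.1, hy.2.trans (by linarith [hu.2])⟩
      · have := hu.1
        have := hu.2.le
        gcongr
    have := norm_image_sub_le_of_norm_deriv_le_segment' hr hbound h ⟨hh, le_rfl⟩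
    have h0 : r 0 = 0 := by
      simp only [r, Finset.sum_range_succ']
      simp
    rw [h0, sub_zero, sub_zero] at this
    calc _ ≤ M * h ^ N * h := this
      _ = _ := by ring

/-- A geometric series with `1 - exp (-h) ≥ h / 2`: summing over the grid costs one power of `h`. -/
lemma sum_exp_neg_le {h : ℝ} (h0 : 0 < h) (h1 : h ≤ 1) (N : ℕ) :
    ∑ d ∈ Finset.range N, Real.exp (-(d * h)) ≤ 2 / h := by
  have hr : ∀ d : ℕ, Real.exp (-(d * h)) = Real.exp (-h) ^ d := by
    intro d
    rw [← Real.exp_nat_mul]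
    congr 1
    ring
  have hlt : Real.exp (-h) < 1 := by simpa using h0
  have h2 : h / 2 ≤ 1 - Real.exp (-h) := by
    have h3 : Real.exp (-h) ≤ 1 / (1 + h) := by
      rw [Real.exp_neg, ← one_div]
      exact one_div_le_one_div_of_le (by linarith) (by linarith [Real.add_one_le_exp h])
    have h4 : 1 / (1 + h) ≤ 1 - h / 2 := by
      rw [div_le_iff₀ (by linarith)]
      nlinarith
    linarith
  simp_rw [hr]
  calc _ ≤ (1 - Real.exp (-h))⁻¹ :=
        sum_le_hasSum _ (fun _ _ => by positivity)
          (hasSum_geometric_of_lt_one (Real.exp_pos _).le hlt)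
    _ ≤ (h / 2)⁻¹ := by gcongr
    _ = 2 / h := by rw [inv_div]

lemma summable_polyGauss (p : ℝ[X]) {h : ℝ} (h0 : 0 < h) (h1 : h ≤ 1) :
    Summable fun d : ℕ => polyGauss p (d * h) := by
  obtain ⟨C, hC, hp⟩ := exists_abs_polyGauss_le p
  refine Summable.of_norm (summable_of_sum_range_le (c := C * (2 / h)) (fun _ => norm_nonneg _) ?_)
  intro N
  calc _ ≤ ∑ d ∈ Finset.range N, C * Real.exp (-(d * h)) :=
        Finset.sum_le_sum fun d _ => hp _ (by positivity)
    _ = C * ∑ d ∈ Finset.range N, Real.exp (-(d * h)) := by rw [Finset.mul_sum]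
    _ ≤ _ := by
      gcongr
      exact sum_exp_neg_le h0 h1 N

/-- The first terms of the Euler–Maclaurin expansion of `∑ d, f (d * h)` in `h`, where
`f x = p(x) exp (-x² / 2)`. -/
noncomputable def eulerMaclaurin (p : ℝ[X]) (h : ℝ) : ℝ :=
  halfMoment p / h + p.coeff 0 / 2 - h * p.coeff 1 / 12
    + h ^ 3 * (6 * p.coeff 3 - 3 * p.coeff 1) / 720

lemma eval_zero_gaussDeriv (p : ℝ[X]) : (gaussDeriv p).eval 0 = p.coeff 1 := by
  rw [← coeff_zero_eq_eval_zero]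
  simp [gaussDeriv, coeff_derivative]

lemma eval_zero_gaussDeriv_three (p : ℝ[X]) :
    (gaussDeriv (gaussDeriv (gaussDeriv p))).eval 0 = 6 * p.coeff 3 - 3 * p.coeff 1 := by
  rw [eval_zero_gaussDeriv]
  simp [gaussDeriv, coeff_derivative, coeff_X_mul]
  ring

/-- Each term `h f(x)` is an increment of a corrected antiderivative `Ψ` up to `h^7 exp (-x)`.
Telescoping and summing the errors leaves `h^6`, and dividing by `h` gives `h^5`. The boundary terms
at infinity vanish. -/
theorem abs_tsum_polyGauss_sub_le (p : ℝ[X]) :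
    ∃ C : ℝ, ∀ h : ℝ, 0 < h → h ≤ 1 →
      |∑' d : ℕ, polyGauss p (d * h) - eulerMaclaurin p h| ≤ C * h ^ 5 := by
  let F : ℝ → ℝ := fun x => ∫ t in (0 : ℝ)..x, polyGauss p t
  -- Indices are shifted by one: `g 0` is the antiderivative and `g 1` the function itself.
  let g : ℕ → ℝ → ℝ := fun k => Nat.casesOn k F fun k => polyGauss (gaussDeriv^[k] p)
  have hg : ∀ k y, HasDerivAt (g k) (g (k + 1) y) y := by
    intro k y
    cases k with
    | zero =>
      exact intervalIntegral.integral_hasDerivAt_right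
        ((continuous_polyGauss p).intervalIntegrable _ _)
        (continuous_polyGauss p).aestronglyMeasurable.stronglyMeasurableAtFilter
        (continuous_polyGauss p).continuousAt
    | succ k =>
      change HasDerivAt (polyGauss (gaussDeriv^[k] p)) (polyGauss (gaussDeriv^[k + 1] p) y) y
      rw [Function.iterate_succ_apply']
      exact hasDerivAt_polyGauss _ y
  obtain ⟨C, hC, hb⟩ := exists_abs_polyGauss_le (gaussDeriv^[6] p)
  refine ⟨4 * C, fun h h0 h1 => ?_⟩
  -- The coefficients are the Bernoulli quotients `B_k / k!`.
  let Ψ : ℝ → ℝ := fun x => g 0 x - h / 2 * g 1 x + h ^ 2 / 12 * g 2 x - h ^ 4 / 720 * g 4 x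
  have hstep : ∀ x, 0 ≤ x → |h * g 1 x - (Ψ (x + h) - Ψ x)| ≤ 2 * C * h ^ 7 * Real.exp (-x) := by
    intro x hx
    have hM : ∀ y ∈ Set.Icc x (x + h), |g 7 y| ≤ C * Real.exp (-x) := by
      intro y hy
      refine (hb y (hx.trans hy.1)).trans ?_
      gcongr
      exact hy.1
    -- The orders 7, 6, 5, 3 match the prefactors `1, h, h², h⁴`, so every remainder is of order
    -- `h^7` and involves only `g 7`.
    have t0 := abs_sub_taylor_le 7 g x h _ h0.le hg hM
    have t1 := abs_sub_taylor_le 6 (fun k => g (k + 1)) x h _ h0.le (fun k => hg (k + 1)) hM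
    have t2 := abs_sub_taylor_le 5 (fun k => g (k + 2)) x h _ h0.le (fun k => hg (k + 2)) hM
    have t4 := abs_sub_taylor_le 3 (fun k => g (k + 4)) x h _ h0.le (fun k => hg (k + 4)) hM
    simp only [Finset.sum_range_succ, Finset.sum_range_zero, Nat.factorial, Nat.reduceAdd,
      Nat.reduceMul, zero_add, Nat.cast_one, Nat.cast_ofNat, Nat.succ_eq_add_one] at t0 t1 t2 t4
    generalize hE : Real.exp (-x) = E at *
    have hE0 : 0 < E := hE ▸ Real.exp_pos _
    set r0 := g 0 (x + h) - _ with hr0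
    set r1 := g 1 (x + h) - _ with hr1
    set r2 := g 2 (x + h) - _ with hr2
    set r4 := g 4 (x + h) - _ with hr4
    have key : h * g 1 x - (Ψ (x + h) - Ψ x) =
        -r0 + h / 2 * r1 - h ^ 2 / 12 * r2 + h ^ 4 / 720 * r4 := by
      simp only [Ψ, hr0, hr1, hr2, hr4]
      ring
    rw [key]
    have b1 : |h / 2 * r1| ≤ h / 2 * (C * E * h ^ 6) := by
      rw [abs_mul, abs_of_pos (by positivity)]
      gcongr
    have b2 : |h ^ 2 / 12 * r2| ≤ h ^ 2 / 12 * (C * E * h ^ 5) := by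
      rw [abs_mul, abs_of_pos (by positivity)]
      gcongr
    have b4 : |h ^ 4 / 720 * r4| ≤ h ^ 4 / 720 * (C * E * h ^ 3) := by
      rw [abs_mul, abs_of_pos (by positivity)]
      gcongr
    have hpos : 0 ≤ C * E * h ^ 7 := by positivity
    have e1 : h / 2 * (C * E * h ^ 6) = C * E * h ^ 7 / 2 := by ring
    have e2 : h ^ 2 / 12 * (C * E * h ^ 5) = C * E * h ^ 7 / 12 := by ring
    have e4 : h ^ 4 / 720 * (C * E * h ^ 3) = C * E * h ^ 7 / 720 := by ring
    have e5 : 2 * C * h ^ 7 * E = 2 * (C * E * h ^ 7) := by ring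
    rw [e1] at b1
    rw [e2] at b2
    rw [e4] at b4
    rw [e5]
    rw [abs_le] at *
    constructor <;> linarith [t0.1, t0.2, b1.1, b1.2, b2.1, b2.2, b4.1, b4.2]
  have hfin : ∀ N : ℕ, |h * ∑ d ∈ Finset.range N, g 1 (d * h) - (Ψ (N * h) - Ψ 0)| ≤
      4 * C * h ^ 6 := by
    intro N
    have htel : Ψ (N * h) - Ψ 0 = ∑ d ∈ Finset.range N, (Ψ (d * h + h) - Ψ (d * h)) := by
      have := Finset.sum_range_sub (fun d : ℕ => Ψ (d * h)) N
      simp only [Nat.cast_zero, zero_mul] at this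
      rw [← this]
      refine Finset.sum_congr rfl fun d _ => ?_
      push_cast
      ring_nf
    rw [htel, Finset.mul_sum, ← Finset.sum_sub_distrib]
    calc _ ≤ ∑ d ∈ Finset.range N, 2 * C * h ^ 7 * Real.exp (-(d * h)) :=
          (Finset.abs_sum_le_sum_abs _ _).trans
            (Finset.sum_le_sum fun d _ => hstep _ (by positivity))
      _ = 2 * C * h ^ 7 * ∑ d ∈ Finset.range N, Real.exp (-(d * h)) := by rw [Finset.mul_sum]
      _ ≤ 2 * C * h ^ 7 * (2 / h) := by
          gcongr
          exact sum_exp_neg_le h0 h1 N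
      _ = 4 * C * h ^ 6 := by
          field_simp
          ring
  have hNh : Tendsto (fun N : ℕ => (N : ℝ) * h) atTop atTop :=
    tendsto_natCast_atTop_atTop.atTop_mul_const h0
  have hF : Tendsto (fun N : ℕ => g 0 (N * h)) atTop (nhds (halfMoment p)) :=
    (intervalIntegral_tendsto_integral_Ioi 0 (integrableOn_polyGauss p) tendsto_id).comp hNh
  have hΨ : Tendsto (fun N : ℕ => Ψ (N * h)) atTop (nhds (halfMoment p)) := by
    have hk : ∀ k, Tendsto (fun N : ℕ => g (k + 1) (N * h)) atTop (nhds 0) := fun k =>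
      (tendsto_polyGauss (gaussDeriv^[k] p)).comp hNh
    have := ((hF.sub ((hk 0).const_mul (h / 2))).add ((hk 1).const_mul (h ^ 2 / 12))).sub
      ((hk 3).const_mul (h ^ 4 / 720))
    simpa using this
  have hlim := (((summable_polyGauss p h0 h1).hasSum.tendsto_sum_nat.const_mul h).sub
    (hΨ.sub_const (Ψ 0))).abs
  have hle := le_of_tendsto' hlim hfin
  have hΨ0 : Ψ 0 = -(h / 2) * p.coeff 0 + h ^ 2 / 12 * p.coeff 1
      - h ^ 4 / 720 * (6 * p.coeff 3 - 3 * p.coeff 1) := by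
    have e0 : g 0 0 = 0 := intervalIntegral.integral_same
    have e1 : g 1 0 = p.coeff 0 := by
      change polyGauss p 0 = _
      simp [polyGauss, coeff_zero_eq_eval_zero]
    have e2 : g 2 0 = p.coeff 1 := by
      change polyGauss (gaussDeriv p) 0 = _
      simp [polyGauss, eval_zero_gaussDeriv]
    have e4 : g 4 0 = 6 * p.coeff 3 - 3 * p.coeff 1 := by
      change polyGauss (gaussDeriv (gaussDeriv (gaussDeriv p))) 0 = _
      simp [polyGauss, eval_zero_gaussDeriv_three]
    simp only [Ψ, e0, e1, e2, e4]
    ring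
  have hmul : h * (∑' d : ℕ, polyGauss p (d * h) - eulerMaclaurin p h) =
      h * ∑' d : ℕ, polyGauss p (d * h) - (halfMoment p - Ψ 0) := by
    rw [hΨ0, eulerMaclaurin]
    field_simp
    ring
  rw [← hmul, abs_mul, abs_of_pos h0] at hle
  have : h * |∑' d : ℕ, polyGauss p (d * h) - eulerMaclaurin p h| ≤ h * (4 * C * h ^ 5) :=
    hle.trans_eq (by ring)
  exact le_of_mul_le_mul_left this h0

end GaussianSums

/-! ### Exponentiating the truncated logarithmic expansion. -/

section Expansion

/-- `f x h` is bounded by a power of `1 + x`, uniformly for `0 ≤ h ≤ 1`. -/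
def PolyBounded (f : ℝ → ℝ → ℝ) : Prop :=
  ∃ C : ℝ, ∃ K : ℕ, 0 ≤ C ∧ ∀ x h : ℝ, 0 ≤ x → 0 ≤ h → h ≤ 1 → |f x h| ≤ C * (1 + x) ^ K

namespace PolyBounded

variable {f g : ℝ → ℝ → ℝ}

lemma const (c : ℝ) : PolyBounded fun _ _ => c :=
  ⟨|c|, 0, abs_nonneg c, fun x h _ _ _ => by simp⟩

lemma fst : PolyBounded fun x _ => x :=
  ⟨1, 1, zero_le_one, fun x h hx _ _ => by rw [abs_of_nonneg hx]; linarith⟩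

lemma snd : PolyBounded fun _ h => h :=
  ⟨1, 0, zero_le_one, fun x h _ h0 h1 => by rw [abs_of_nonneg h0]; linarith⟩

lemma add (hf : PolyBounded f) (hg : PolyBounded g) : PolyBounded fun x h => f x h + g x h := by
  obtain ⟨C, K, hC, hf⟩ := hf
  obtain ⟨C', K', hC', hg⟩ := hg
  refine ⟨C + C', K + K', by positivity, fun x h hx h0 h1 => ?_⟩
  rw [add_mul]
  refine (abs_add_le _ _).trans
    (add_le_add ((hf x h hx h0 h1).trans ?_) ((hg x h hx h0 h1).trans ?_))
  · gcongr
    · linarith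
    · omega
  · gcongr
    · linarith
    · omega

lemma mul (hf : PolyBounded f) (hg : PolyBounded g) : PolyBounded fun x h => f x h * g x h := by
  obtain ⟨C, K, hC, hf⟩ := hf
  obtain ⟨C', K', hC', hg⟩ := hg
  refine ⟨C * C', K + K', by positivity, fun x h hx h0 h1 => ?_⟩
  rw [abs_mul, pow_add, mul_mul_mul_comm]
  exact mul_le_mul (hf x h hx h0 h1) (hg x h hx h0 h1) (abs_nonneg _) (by positivity)

lemma neg (hf : PolyBounded f) : PolyBounded fun x h => -f x h := by
  obtain ⟨C, K, hC, hf⟩ := hf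
  exact ⟨C, K, hC, fun x h hx h0 h1 => by rw [abs_neg]; exact hf x h hx h0 h1⟩

lemma sub (hf : PolyBounded f) (hg : PolyBounded g) : PolyBounded fun x h => f x h - g x h := by
  simpa only [sub_eq_add_neg] using hf.add hg.neg

lemma pow (hf : PolyBounded f) (k : ℕ) : PolyBounded fun x h => f x h ^ k := by
  induction k with
  | zero => simpa using const 1
  | succ k ih => simpa only [pow_succ] using ih.mul hf

lemma div_const (hf : PolyBounded f) (c : ℝ) : PolyBounded fun x h => f x h / c := by
  simpa only [div_eq_mul_inv] using hf.mul (const c⁻¹)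

lemma abs (hf : PolyBounded f) : PolyBounded fun x h => |f x h| := by
  obtain ⟨C, K, hC, hf⟩ := hf
  exact ⟨C, K, hC, fun x h hx h0 h1 => by rw [abs_abs]; exact hf x h hx h0 h1⟩

end PolyBounded

/-- The coefficient of `h ^ j` in the expansion of `log (tailProb n d) + x ^ 2 / 2`, where
`h = n ^ (-1 / 2)` and `x = d * h`, for `j = 1, …, 5`. -/
noncomputable def logCoeff : ℕ → ℝ → ℝ
  | 1, x => -x ^ 3 / 3 - x / 2
  | 2, x => -x ^ 4 / 4 - x ^ 2 / 4
  | 3, x => -x ^ 5 / 5 - x ^ 3 / 6 + x / 12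
  | 4, x => -x ^ 6 / 6 - x ^ 4 / 8 + x ^ 2 / 12
  | 5, x => -x ^ 7 / 7 - x ^ 5 / 10 + x ^ 3 / 12
  | _, _ => 0

/-- The truncated expansion of `log (tailProb n d) + x ^ 2 / 2`. -/
noncomputable def logExpansion (x h : ℝ) : ℝ :=
  h * logCoeff 1 x + h ^ 2 * logCoeff 2 x + h ^ 3 * logCoeff 3 x + h ^ 4 * logCoeff 4 x
    + h ^ 5 * logCoeff 5 x

open Polynomial in
/-- The coefficient of `h ^ j` in the expansion of `exp (logExpansion x h)`, for `j ≤ 5`. -/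
noncomputable def expCoeff : ℕ → ℝ[X]
  | 0 => 1
  | 1 => C (-1 / 2) * X ^ 1 + C (-1 / 3) * X ^ 3
  | 2 => C (-1 / 8) * X ^ 2 + C (-1 / 12) * X ^ 4 + C (1 / 18) * X ^ 6
  | 3 => C (1 / 12) * X ^ 1 + C (-1 / 16) * X ^ 3 + C (-1 / 30) * X ^ 5 + C (1 / 18) * X ^ 7
      + C (-1 / 162) * X ^ 9
  | 4 => C (1 / 24) * X ^ 2 + C (-77 / 1152) * X ^ 4 + C (-7 / 480) * X ^ 6
      + C (71 / 1440) * X ^ 8 + C (-7 / 648) * X ^ 10 + C (1 / 1944) * X ^ 12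
  | 5 => C (1 / 32) * X ^ 3 + C (-143 / 2304) * X ^ 5 + C (-151 / 120960) * X ^ 7
      + C (41 / 960) * X ^ 9 + C (-179 / 12960) * X ^ 11 + C (5 / 3888) * X ^ 13
      + C (-1 / 29160) * X ^ 15
  | _ => 0

lemma polyBounded_eval (p : Polynomial ℝ) : PolyBounded fun x _ => p.eval x := by
  obtain ⟨C, K, hC, h⟩ := exists_abs_eval_le p
  exact ⟨C, K, hC, fun x _ hx _ _ => h x hx⟩

lemma polyBounded_logCoeff (j : ℕ) : PolyBounded fun x _ => logCoeff j x := by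
  have P : ∀ k, PolyBounded fun x _ => x ^ k := fun k => PolyBounded.fst.pow k
  have N : ∀ k, PolyBounded fun x _ => -x ^ k := fun k => (P k).neg
  match j with
  | 0 => exact PolyBounded.const 0
  | 1 => exact ((N 3).div_const 3).sub (PolyBounded.fst.div_const 2)
  | 2 => exact ((N 4).div_const 4).sub ((P 2).div_const 4)
  | 3 => exact (((N 5).div_const 5).sub ((P 3).div_const 6)).add (PolyBounded.fst.div_const 12)
  | 4 => exact (((N 6).div_const 6).sub ((P 4).div_const 8)).add ((P 2).div_const 12)
  | 5 => exact (((N 7).div_const 7).sub ((P 5).div_const 10)).add ((P 3).div_const 12)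
  | _ + 6 => exact PolyBounded.const 0

/-- The truncated expansion of `exp (logExpansion x h)`. -/
noncomputable def expExpansion (x h : ℝ) : ℝ :=
  ∑ j ∈ Finset.range 6, h ^ j * (expCoeff j).eval x

lemma polyBounded_expExpansion : PolyBounded expExpansion := by
  have P : ∀ j, PolyBounded fun x h => h ^ j * (expCoeff j).eval x := fun j =>
    (PolyBounded.snd.pow j).mul (polyBounded_eval _)
  unfold expExpansion
  simp only [Finset.sum_range_succ, Finset.sum_range_zero, zero_add]
  exact (((((P 0).add (P 1)).add (P 2)).add (P 3)).add (P 4)).add (P 5)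

/-- The `h`-derivative of `logExpansion`. -/
noncomputable def logExpansionDeriv (x h : ℝ) : ℝ :=
  logCoeff 1 x + 2 * h * logCoeff 2 x + 3 * h ^ 2 * logCoeff 3 x + 4 * h ^ 3 * logCoeff 4 x
    + 5 * h ^ 4 * logCoeff 5 x

lemma hasDerivAt_logExpansion (x h : ℝ) :
    HasDerivAt (logExpansion x) (logExpansionDeriv x h) h := by
  have P : ∀ (k : ℕ) (c : ℝ), HasDerivAt (fun h : ℝ => h ^ k * c) (k * h ^ (k - 1) * c) h :=
    fun k c => (hasDerivAt_pow k h).mul_const c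
  have := (((((hasDerivAt_id h).mul_const (logCoeff 1 x)).add (P 2 (logCoeff 2 x))).add
    (P 3 (logCoeff 3 x))).add (P 4 (logCoeff 4 x))).add (P 5 (logCoeff 5 x))
  refine this.congr_deriv ?_
  rw [logExpansionDeriv]
  push_cast
  ring

/-- The only positive terms come from `x / 12`, `x² / 12`, `x³ / 12`; for `h ≤ 1` negative terms
with the same power of `x` absorb them. -/
lemma logExpansionDeriv_nonpos {x h : ℝ} (hx : 0 ≤ x) (h0 : 0 ≤ h) (h1 : h ≤ 1) :
    logExpansionDeriv x h ≤ 0 := by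
  have hh : h ^ 2 ≤ 1 := pow_le_one₀ h0 h1
  have e : logExpansionDeriv x h =
      -(x ^ 3 * (1 / 3 + h ^ 2 / 2 - 5 / 12 * (h ^ 2 * h ^ 2))
        + x ^ 2 * (h * (1 / 2 - h ^ 2 / 3)) + x * (1 / 2 - h ^ 2 / 4)
        + h * x ^ 4 / 2 + 3 / 5 * h ^ 2 * x ^ 5 + 4 * h ^ 3 * (x ^ 6 / 6 + x ^ 4 / 8)
        + 5 * h ^ 4 * (x ^ 7 / 7 + x ^ 5 / 10)) := by
    simp only [logExpansionDeriv, logCoeff]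
    ring
  rw [e, neg_nonpos]
  have h2 : h ^ 2 * h ^ 2 ≤ h ^ 2 := by nlinarith [sq_nonneg h]
  have i1 : 0 ≤ 1 / 3 + h ^ 2 / 2 - 5 / 12 * (h ^ 2 * h ^ 2) := by nlinarith [sq_nonneg h]
  have i2 : 0 ≤ 1 / 2 - h ^ 2 / 3 := by linarith
  have i3 : 0 ≤ 1 / 2 - h ^ 2 / 4 := by linarith
  positivity

lemma antitoneOn_logExpansion {x : ℝ} (hx : 0 ≤ x) :
    AntitoneOn (logExpansion x) (Set.Icc 0 1) := by
  refine antitoneOn_of_deriv_nonpos (convex_Icc 0 1)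
    (fun h _ => (hasDerivAt_logExpansion x h).continuousAt.continuousWithinAt)
    (fun h _ => (hasDerivAt_logExpansion x h).differentiableAt.differentiableWithinAt) ?_
  intro h hh
  rw [interior_Icc] at hh
  rw [(hasDerivAt_logExpansion x h).deriv]
  exact logExpansionDeriv_nonpos hx hh.1.le hh.2.le

lemma logExpansion_nonpos {x h : ℝ} (hx : 0 ≤ x) (h0 : 0 ≤ h) (h1 : h ≤ 1) :
    logExpansion x h ≤ 0 := by
  have := antitoneOn_logExpansion hx (Set.left_mem_Icc.2 zero_le_one) ⟨h0, h1⟩ h0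
  simpa [logExpansion] using this

/-- Comparing coefficients in `E' = L' E` for `E = exp L` gives `j c_j = ∑ i ℓ_i c_(j-i)`. -/
lemma expCoeff_eval_relations (x : ℝ) :
    (expCoeff 0).eval x = 1 ∧
    (expCoeff 1).eval x = logCoeff 1 x ∧
    2 * (expCoeff 2).eval x = logCoeff 1 x * (expCoeff 1).eval x + 2 * logCoeff 2 x ∧
    3 * (expCoeff 3).eval x = logCoeff 1 x * (expCoeff 2).eval x
      + 2 * logCoeff 2 x * (expCoeff 1).eval x + 3 * logCoeff 3 x ∧
    4 * (expCoeff 4).eval x = logCoeff 1 x * (expCoeff 3).eval x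
      + 2 * logCoeff 2 x * (expCoeff 2).eval x + 3 * logCoeff 3 x * (expCoeff 1).eval x
      + 4 * logCoeff 4 x ∧
    5 * (expCoeff 5).eval x = logCoeff 1 x * (expCoeff 4).eval x
      + 2 * logCoeff 2 x * (expCoeff 3).eval x + 3 * logCoeff 3 x * (expCoeff 2).eval x
      + 4 * logCoeff 4 x * (expCoeff 1).eval x + 5 * logCoeff 5 x := by
  simp only [expCoeff, logCoeff, Polynomial.eval_add, Polynomial.eval_mul, Polynomial.eval_C,
    Polynomial.eval_pow, Polynomial.eval_X, Polynomial.eval_one]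
  refine ⟨trivial, ?_, ?_, ?_, ?_, ?_⟩ <;> ring

/-- The remainder in the differential equation that `expExpansion` satisfies approximately. -/
noncomputable def expDefect (x h : ℝ) : ℝ :=
  ∑ m ∈ Finset.range 5, h ^ m * ∑ i ∈ Finset.Icc (m + 1) 5,
    ((i : ℝ) * logCoeff i x) * (expCoeff (m + 6 - i)).eval x

lemma polyBounded_expDefect : PolyBounded expDefect := by
  have P : ∀ i j, PolyBounded fun x _ => ((i : ℕ) : ℝ) * logCoeff i x * (expCoeff j).eval x :=
    fun i j => ((PolyBounded.const _).mul (polyBounded_logCoeff i)).mul (polyBounded_eval _)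
  have S : ∀ (s : Finset ℕ) (F : ℕ → ℝ → ℝ → ℝ), (∀ i, PolyBounded (F i)) →
      PolyBounded fun x h => ∑ i ∈ s, F i x h := by
    intro s F hF
    induction s using Finset.induction_on with
    | empty => simpa using PolyBounded.const 0
    | insert i s hi ih =>
      simp only [Finset.sum_insert hi]
      exact (hF i).add ih
  exact S _ _ fun m => (PolyBounded.snd.pow m).mul (S _ _ fun i => P i _)

lemma hasDerivAt_expExpansion (x h : ℝ) :
    HasDerivAt (expExpansion x)
      (logExpansionDeriv x h * expExpansion x h - h ^ 5 * expDefect x h) h := by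
  have h1 : HasDerivAt (expExpansion x)
      (∑ j ∈ Finset.range 6, (j * h ^ (j - 1)) * (expCoeff j).eval x) h :=
    HasDerivAt.fun_sum fun j _ => (hasDerivAt_pow j h).mul_const _
  refine h1.congr_deriv ?_
  obtain ⟨e0, e1, e2, e3, e4, e5⟩ := expCoeff_eval_relations x
  simp only [expDefect, expExpansion, logExpansionDeriv, Finset.sum_range_succ,
    Finset.sum_range_zero, show Finset.Icc 1 5 = {1, 2, 3, 4, 5} from rfl,
    show Finset.Icc 2 5 = {2, 3, 4, 5} from rfl, show Finset.Icc 3 5 = {3, 4, 5} from rfl,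
    show Finset.Icc 4 5 = {4, 5} from rfl, Nat.reduceAdd,
    show Finset.Icc 5 5 = {5} from rfl, zero_add]
  simp [e0]
  linear_combination e1 + h * e2 + h ^ 2 * e3 + h ^ 3 * e4 + h ^ 4 * e5

/-- A Grönwall argument in `h`: with `E` the expansion and `L` the exponent, `E exp (-L)` has
derivative `-h^5 exp (-L)` times the defect. Since `L` decreases in `h`, `exp (-L)` is largest at
the right end, where the final factor `exp L` cancels it. -/
theorem exists_abs_exp_logExpansion_sub_le :
    ∃ C : ℝ, ∃ K : ℕ, 0 ≤ C ∧ ∀ x h : ℝ, 0 ≤ x → 0 ≤ h → h ≤ 1 →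
      |Real.exp (logExpansion x h) - expExpansion x h| ≤ C * (1 + x) ^ K * h ^ 6 := by
  obtain ⟨C, K, hC, hr⟩ := polyBounded_expDefect
  refine ⟨C, K, hC, fun x h hx h0 h1 => ?_⟩
  let φ : ℝ → ℝ := fun t => expExpansion x t * Real.exp (-logExpansion x t)
  have hφ : ∀ t, HasDerivAt φ (-(t ^ 5 * expDefect x t) * Real.exp (-logExpansion x t)) t := by
    intro t
    refine ((hasDerivAt_expExpansion x t).mul (hasDerivAt_logExpansion x t).fun_neg.exp).congr_deriv
      ?_
    ring
  have hb : ∀ t ∈ Set.Ico 0 h, ‖-(t ^ 5 * expDefect x t) * Real.exp (-logExpansion x t)‖ ≤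
      h ^ 5 * (C * (1 + x) ^ K) * Real.exp (-logExpansion x h) := by
    intro t ht
    have ht1 : t ≤ 1 := ht.2.le.trans h1
    have := antitoneOn_logExpansion hx ⟨ht.1, ht1⟩ ⟨h0, h1⟩ ht.2.le
    rw [Real.norm_eq_abs, abs_mul, abs_neg, abs_mul, Real.abs_exp, abs_of_nonneg (pow_nonneg ht.1 5)]
    have h2 := hr x t hx ht.1 ht1
    have h3 := ht.1
    have h4 := ht.2.le
    gcongr
  have := norm_image_sub_le_of_norm_deriv_le_segment'
    (fun t _ => (hφ t).hasDerivWithinAt) hb h ⟨h0, le_rfl⟩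
  have hφ0 : φ 0 = 1 := by
    simp [φ, expExpansion, logExpansion, Finset.sum_range_succ, expCoeff]
  have hmul : Real.exp (logExpansion x h) - expExpansion x h =
      -(Real.exp (logExpansion x h) * (φ h - φ 0)) := by
    have : Real.exp (logExpansion x h) * Real.exp (-logExpansion x h) = 1 := by
      rw [← Real.exp_add]
      simp
    simp only [hφ0, φ]
    linear_combination expExpansion x h * this
  rw [hmul, abs_neg, abs_mul, Real.abs_exp]
  calc _ ≤ Real.exp (logExpansion x h) *
        (h ^ 5 * (C * (1 + x) ^ K) * Real.exp (-logExpansion x h) * (h - 0)) := by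
        gcongr
        exact this
    _ = C * (1 + x) ^ K * h ^ 6 *
        (Real.exp (logExpansion x h) * Real.exp (-logExpansion x h)) := by ring
    _ = _ := by
        rw [← Real.exp_add]
        simp

end Expansion

/-! ### Uniform asymptotics of the tail probabilities. -/

section TailProb

lemma tailProb_eq_zero {n d : ℕ} (h : n < d) : tailProb n d = 0 := by
  simp [tailProb, Nat.descFactorial_of_lt h]

lemma tailProb_zero (n : ℕ) : tailProb n 0 = 1 := by
  simp [tailProb]

lemma tailProb_nonneg (n d : ℕ) : 0 ≤ tailProb n d := by
  unfold tailProb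
  positivity

lemma tailProb_eq_prod {n d : ℕ} (hd : d ≤ n) :
    tailProb n d = ∏ j ∈ Finset.range d, ((n : ℝ) - d) / (n - j) := by
  rw [tailProb, Nat.descFactorial_eq_prod_range, Finset.prod_div_distrib, Finset.prod_const,
    Finset.card_range, Nat.cast_sub hd, Nat.cast_prod]
  congr 1
  refine Finset.prod_congr rfl fun j hj => ?_
  rw [Nat.cast_sub]
  exact (Finset.mem_range.1 hj).le.trans hd

/-- Each factor is `1 - (d - j)/(n - j) ≤ exp (-(d - j)/n)`, and the exponents add up to `-d(d +
1)/(2n)`. -/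
lemma tailProb_le_exp {n : ℕ} (hn : 1 ≤ n) (d : ℕ) :
    tailProb n d ≤ Real.exp (-((d : ℝ) ^ 2 / n) / 2) := by
  rcases Nat.lt_or_ge n d with h | hd
  · rw [tailProb_eq_zero h]
    positivity
  have hn0 : (0 : ℝ) < n := by exact_mod_cast hn
  have hdn : (d : ℝ) ≤ n := by exact_mod_cast hd
  have hsum : ∀ d : ℕ, ∑ j ∈ Finset.range d, (-(((d : ℝ) - j) / n)) = -(d * (d + 1) / 2) / n := by
    intro d
    rw [Finset.sum_neg_distrib, ← Finset.sum_div, Finset.sum_sub_distrib, Finset.sum_const,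
      Finset.card_range, nsmul_eq_mul]
    have : ∑ j ∈ Finset.range d, (j : ℝ) = d * (d - 1) / 2 := by
      induction d with
      | zero => simp
      | succ d ih =>
        rw [Finset.sum_range_succ, ih]
        push_cast
        ring
    rw [this]
    ring
  rw [tailProb_eq_prod hd]
  calc _ ≤ ∏ j ∈ Finset.range d, Real.exp (-(((d : ℝ) - j) / n)) := by
        refine Finset.prod_le_prod (fun j hj => ?_) fun j hj => ?_
        · have hjd : (j : ℝ) < d := by exact_mod_cast Finset.mem_range.1 hj
          exact div_nonneg (by linarith) (by linarith)
        · have hjd : (j : ℝ) < d := by exact_mod_cast Finset.mem_range.1 hj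
          have hnj : (0 : ℝ) < n - j := by linarith
          have hj0 : (0 : ℝ) ≤ j := Nat.cast_nonneg j
          have h1 : ((n : ℝ) - d) / (n - j) = 1 - (d - j) / (n - j) := by
            field_simp
            ring
          have h2 : ((d : ℝ) - j) / n ≤ (d - j) / (n - j) :=
            div_le_div_of_nonneg_left (by linarith) hnj (by linarith)
          linarith [Real.add_one_le_exp (-(((d : ℝ) - j) / n))]
    _ = Real.exp (-(d * (d + 1) / 2) / n) := by rw [← Real.exp_sum, hsum]
    _ ≤ _ := by
        rw [Real.exp_le_exp]
        have h1 : -((d : ℝ) * (d + 1) / 2) / n = -((d : ℝ) ^ 2 / n) / 2 - d / n / 2 := by ring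
        have h2 : 0 ≤ (d : ℝ) / n / 2 := by positivity
        linarith

/-- Part of the terms of order `h ^ 6` and higher in the expansion of `log (tailProb n d)`. -/
noncomputable def logRemainder (x h : ℝ) : ℝ :=
  -x ^ 6 / 12 + x ^ 4 / 12 + h * (x ^ 5 / 12 - x / 120) - h ^ 2 * (x ^ 2 / 60)
    - h ^ 3 * (x ^ 3 / 36) + h ^ 5 * (x / 252)

lemma polyBounded_logRemainder : PolyBounded logRemainder := by
  have P : ∀ k, PolyBounded fun x _ => x ^ k := fun k => PolyBounded.fst.pow k
  have H : ∀ k, PolyBounded fun _ h => h ^ k := fun k => PolyBounded.snd.pow k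
  exact ((((((P 6).neg.div_const 12).add ((P 4).div_const 12)).add
    (PolyBounded.snd.mul (((P 5).div_const 12).sub (PolyBounded.fst.div_const 120)))).sub
    ((H 2).mul ((P 2).div_const 60))).sub ((H 3).mul ((P 3).div_const 36))).add
    ((H 5).mul (PolyBounded.fst.div_const 252))

/-- The truncated Taylor series of `-log (1 - u)`. -/
noncomputable def logSeries (u : ℝ) : ℝ := ∑ k ∈ Finset.range 6, u ^ (k + 1) / (k + 1)

lemma abs_log_add_logSeries_le {u : ℝ} (h0 : 0 ≤ u) (h1 : u ≤ 1 / 2) :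
    |Real.log (1 - u) + logSeries u| ≤ 2 * u ^ 7 := by
  have := Real.abs_log_sub_add_sum_range_le (x := u) (by rw [abs_of_nonneg h0]; linarith) 6
  rw [add_comm, logSeries]
  refine this.trans ?_
  rw [abs_of_nonneg h0, div_le_iff₀ (by linarith)]
  nlinarith [mul_nonneg (pow_nonneg h0 7) (sub_nonneg.2 h1), pow_succ u 6]

/-- Once the logarithm is truncated, power sums of `j` are polynomials in `d`, so the identity is
exact and induction on `d` proves it. -/
lemma sum_logSeries (d : ℕ) (h : ℝ) :
    ∑ j ∈ Finset.range d, logSeries (j * h ^ 2) - d * logSeries (d * h ^ 2) =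
      -(d * h) ^ 2 / 2 + logExpansion (d * h) h + h ^ 6 * logRemainder (d * h) h := by
  have key : ∑ j ∈ Finset.range d, logSeries (j * h ^ 2) =
      d * logSeries (d * h ^ 2)
        + (-(d * h) ^ 2 / 2 + logExpansion (d * h) h + h ^ 6 * logRemainder (d * h) h) := by
    simp only [logSeries, logExpansion, logCoeff, logRemainder, Finset.sum_range_succ _ 0,
      Finset.sum_range_succ _ 1, Finset.sum_range_succ _ 2, Finset.sum_range_succ _ 3,
      Finset.sum_range_succ _ 4, Finset.sum_range_succ _ 5, Finset.sum_range_zero]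
    induction d with
    | zero => simp
    | succ d ih =>
      rw [Finset.sum_range_succ, ih]
      push_cast
      ring
  rw [key]
  ring

lemma log_tailProb {n d : ℕ} (hn : 1 ≤ n) (hd : 2 * d ≤ n) :
    0 < tailProb n d ∧ Real.log (tailProb n d) =
      d * Real.log (1 - d * (1 / n)) - ∑ j ∈ Finset.range d, Real.log (1 - j * (1 / (n : ℝ))) := by
  have hn0 : (0 : ℝ) < n := by exact_mod_cast hn
  have hdn : 2 * (d : ℝ) ≤ n := by exact_mod_cast hd
  have hd0 : (0 : ℝ) ≤ d := Nat.cast_nonneg d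
  have hpos : ∀ j ∈ Finset.range (d + 1), 0 < 1 - (j : ℝ) * (1 / n) := by
    intro j hj
    have hjd : (j : ℝ) ≤ d := by exact_mod_cast Nat.lt_succ_iff.1 (Finset.mem_range.1 hj)
    rw [mul_one_div, sub_pos, div_lt_one hn0]
    linarith
  have hprod : tailProb n d =
      ∏ j ∈ Finset.range d, (1 - (d : ℝ) * (1 / n)) / (1 - j * (1 / n)) := by
    rw [tailProb_eq_prod (by omega)]
    refine Finset.prod_congr rfl fun j hj => ?_
    have h1 : (n : ℝ) - d = n * (1 - d * (1 / n)) := by field_simp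
    have h2 : (n : ℝ) - j = n * (1 - j * (1 / n)) := by field_simp
    rw [h1, h2, mul_div_mul_left _ _ hn0.ne']
  have hp : ∀ j ∈ Finset.range d, 0 < (1 - (d : ℝ) * (1 / n)) / (1 - j * (1 / n)) := by
    intro j hj
    exact div_pos (hpos d (by simp))
      (hpos j (Finset.mem_range.2 ((Finset.mem_range.1 hj).trans (Nat.lt_succ_self d))))
  rw [hprod]
  refine ⟨Finset.prod_pos hp, ?_⟩
  rw [Real.log_prod fun j hj => (hp j hj).ne',
    Finset.sum_congr rfl fun j hj => Real.log_div (hpos d (by simp)).ne'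
      (hpos j (Finset.mem_range.2 ((Finset.mem_range.1 hj).trans (Nat.lt_succ_self d)))).ne',
    Finset.sum_sub_distrib, Finset.sum_const, Finset.card_range, nsmul_eq_mul]

/-- The step `n ^ (-1 / 2)`. -/
noncomputable def step (n : ℕ) : ℝ := (√(n : ℝ))⁻¹

lemma step_pos {n : ℕ} (hn : 1 ≤ n) : 0 < step n := by
  have : (0 : ℝ) < n := by exact_mod_cast hn
  unfold step
  positivity

lemma step_le_one {n : ℕ} (hn : 1 ≤ n) : step n ≤ 1 := by
  have : (1 : ℝ) ≤ n := by exact_mod_cast hn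
  exact inv_le_one_of_one_le₀ (Real.one_le_sqrt.2 this)

lemma step_sq (n : ℕ) : step n ^ 2 = 1 / n := by
  rw [step, inv_pow, Real.sq_sqrt (Nat.cast_nonneg n), one_div]

/-- Each truncated logarithm costs at most `2 (d/n)^7`; the `2 d` of them cost `4 d^8 / n^7 = 4 x^8
h^6`, so six terms of the series suffice. -/
lemma exists_abs_log_tailProb_sub_le :
    ∃ C : ℝ, ∃ K : ℕ, 0 ≤ C ∧ ∀ n d : ℕ, 1 ≤ n → 2 * d ≤ n →
      |Real.log (tailProb n d) + (d * step n) ^ 2 / 2 - logExpansion (d * step n) (step n)| ≤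
        C * (1 + d * step n) ^ K * step n ^ 6 := by
  obtain ⟨C, K, hC, hR⟩ := polyBounded_logRemainder.abs.add
    ((PolyBounded.const 4).mul (PolyBounded.fst.pow 8))
  refine ⟨C, K, hC, fun n d hn hd => ?_⟩
  have hn0 : (0 : ℝ) < n := by exact_mod_cast hn
  have hdn : 2 * (d : ℝ) ≤ n := by exact_mod_cast hd
  obtain ⟨-, hlog⟩ := log_tailProb hn hd
  have hs0 := step_pos hn
  have hs := sum_logSeries d (step n)
  rw [step_sq] at hs
  have hbd : ∀ j : ℕ, j ≤ d → |Real.log (1 - j * (1 / n)) + logSeries (j * (1 / n))| ≤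
      2 * (d * (1 / n)) ^ 7 := by
    intro j hj
    have hjd : (j : ℝ) ≤ d := by exact_mod_cast hj
    refine (abs_log_add_logSeries_le (by positivity) ?_).trans ?_
    · rw [mul_one_div, div_le_iff₀ hn0]
      linarith
    · gcongr
  have hsum : |∑ j ∈ Finset.range d, (Real.log (1 - j * (1 / n)) + logSeries (j * (1 / n)))| ≤
      d * (2 * (d * (1 / n)) ^ 7) := by
    refine (Finset.abs_sum_le_sum_abs _ _).trans
      ((Finset.sum_le_sum fun j hj => hbd j (Finset.mem_range.1 hj).le).trans ?_)
    simp
  have hd' : |d * (Real.log (1 - d * (1 / n)) + logSeries (d * (1 / n)))| ≤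
      d * (2 * (d * (1 / n)) ^ 7) := by
    rw [abs_mul, Nat.abs_cast]
    have := hbd d le_rfl
    gcongr
  have e : Real.log (tailProb n d) + (d * step n) ^ 2 / 2 - logExpansion (d * step n) (step n) =
      d * (Real.log (1 - d * (1 / n)) + logSeries (d * (1 / n)))
        - ∑ j ∈ Finset.range d, (Real.log (1 - j * (1 / n)) + logSeries (j * (1 / n)))
        + step n ^ 6 * logRemainder (d * step n) (step n) := by
    rw [hlog, Finset.sum_add_distrib]
    linear_combination hs
  have e2 : (d : ℝ) * (2 * (d * (1 / n)) ^ 7) = 2 * (d * step n) ^ 8 * step n ^ 6 := by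
    rw [← step_sq]
    ring
  rw [e2] at hsum hd'
  have hRn := hR (d * step n) (step n) (by positivity) hs0.le (step_le_one hn)
  rw [abs_of_nonneg (by positivity)] at hRn
  rw [e]
  have h3 : |step n ^ 6 * logRemainder (d * step n) (step n)| =
      step n ^ 6 * |logRemainder (d * step n) (step n)| := by
    rw [abs_mul, abs_of_pos (by positivity)]
  calc _ ≤ 2 * (d * step n) ^ 8 * step n ^ 6 + 2 * (d * step n) ^ 8 * step n ^ 6
        + step n ^ 6 * |logRemainder (d * step n) (step n)| :=
        (abs_add_le _ _).trans (add_le_add ((abs_sub _ _).trans (add_le_add hd' hsum)) h3.le)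
    _ = (|logRemainder (d * step n) (step n)| + 4 * (d * step n) ^ 8) * step n ^ 6 := by ring
    _ ≤ _ := by gcongr

lemma abs_exp_sub_exp_le {u v : ℝ} (hu : u ≤ 0) (hv : v ≤ 0) :
    |Real.exp u - Real.exp v| ≤ |u - v| := by
  have key : ∀ a b : ℝ, a ≤ 0 → Real.exp a - Real.exp b ≤ |a - b| := by
    intro a b ha
    have h1 : Real.exp b = Real.exp a * Real.exp (b - a) := by rw [← Real.exp_add]; ring_nf
    have h2 : Real.exp a ≤ 1 := Real.exp_le_one_iff.2 ha
    have h3 := Real.add_one_le_exp (b - a)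
    have h4 := Real.exp_pos a
    calc Real.exp a - Real.exp b = Real.exp a * (1 - Real.exp (b - a)) := by rw [h1]; ring
      _ ≤ Real.exp a * |a - b| := by
          gcongr
          linarith [le_abs_self (a - b)]
      _ ≤ 1 * |a - b| := by gcongr
      _ = _ := one_mul _
  rw [abs_le']
  exact ⟨key u v hu, by rw [neg_sub, abs_sub_comm]; exact key v u hv⟩

theorem exists_abs_tailProb_sub_le :
    ∃ C : ℝ, ∃ K : ℕ, 0 ≤ C ∧ ∀ n d : ℕ, 1 ≤ n →
      |tailProb n d - expExpansion (d * step n) (step n) * Real.exp (-(d * step n) ^ 2 / 2)| ≤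
        C * (1 + d * step n) ^ K * step n ^ 6 * Real.exp (-(d * step n) ^ 2 / 2) := by
  obtain ⟨C₁, K₁, hC₁, h₁⟩ := exists_abs_log_tailProb_sub_le
  obtain ⟨C₂, K₂, hC₂, h₂⟩ := exists_abs_exp_logExpansion_sub_le
  obtain ⟨C, K, hC, hR⟩ := (((PolyBounded.const C₁).mul
    (((PolyBounded.const 1).add PolyBounded.fst).pow K₁)).add ((PolyBounded.const C₂).mul
    (((PolyBounded.const 1).add PolyBounded.fst).pow K₂))).add
    (((PolyBounded.const 1).add polyBounded_expExpansion.abs).mul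
      ((PolyBounded.const 64).mul (PolyBounded.fst.pow 6)))
  refine ⟨C, K, hC, fun n d hn => ?_⟩
  have hs0 := step_pos hn
  have hs1 := step_le_one hn
  have hn0 : (0 : ℝ) < n := by exact_mod_cast hn
  have hxd : ((d : ℝ) * step n) ^ 2 = d ^ 2 / n := by
    rw [mul_pow, step_sq, mul_one_div]
  have hx : 0 ≤ d * step n := by positivity
  have hT := tailProb_le_exp hn d
  rw [← hxd] at hT
  have hT' : tailProb n d ≤ Real.exp (-(d * step n) ^ 2 / 2) := hT
  have hRn := hR (d * step n) (step n) hx hs0.le hs1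
  rw [abs_of_nonneg (by positivity)] at hRn
  refine le_trans ?_ (mul_le_mul_of_nonneg_right
    (mul_le_mul_of_nonneg_right hRn (by positivity : 0 ≤ step n ^ 6)) (Real.exp_pos _).le)
  rcases Nat.lt_or_ge n (2 * d) with hd | hd
  · have hdn : (n : ℝ) < 2 * d := by exact_mod_cast hd
    -- For `2 d > n` no expansion is needed: `(2 d / n)^6 = 64 x^6 h^6` exceeds `1`, so the crude
    -- Gaussian bound is already within the error.
    have h6 : 1 ≤ 64 * (d * step n) ^ 6 * step n ^ 6 := by
      have h1 : 1 ≤ 2 * (d : ℝ) * (1 / n) := by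
        rw [mul_one_div, le_div_iff₀ hn0]
        linarith
      calc (1 : ℝ) ≤ (2 * (d : ℝ) * (1 / n)) ^ 6 := one_le_pow₀ h1
        _ = _ := by
          rw [← step_sq]
          ring
    generalize Real.exp (-(d * step n) ^ 2 / 2) = w at *
    have hw : 0 ≤ w := (tailProb_nonneg n d).trans hT'
    calc |tailProb n d - expExpansion (d * step n) (step n) * w|
        ≤ w + |expExpansion (d * step n) (step n)| * w := by
          refine (abs_sub _ _).trans (add_le_add ?_ ?_)
          · rwa [abs_of_nonneg (tailProb_nonneg n d)]
          · rw [abs_mul, abs_of_nonneg hw]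
      _ = (1 + |expExpansion (d * step n) (step n)|) * 1 * w := by ring
      _ ≤ (1 + |expExpansion (d * step n) (step n)|) * (64 * (d * step n) ^ 6 * step n ^ 6) * w := by
          gcongr
      _ = (0 + 0 + (1 + |expExpansion (d * step n) (step n)|) * (64 * (d * step n) ^ 6))
            * step n ^ 6 * w := by ring
      _ ≤ _ := by
          have p1 : 0 ≤ C₁ * (1 + d * step n) ^ K₁ := by positivity
          have p2 : 0 ≤ C₂ * (1 + d * step n) ^ K₂ := by positivity
          exact mul_le_mul_of_nonneg_right
            (mul_le_mul_of_nonneg_right (by linarith) (by positivity)) hw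
  · obtain ⟨hpos, -⟩ := log_tailProb hn hd
    have b1 := h₁ n d hn hd
    have b2 := h₂ (d * step n) (step n) hx hs0.le hs1
    have hA := logExpansion_nonpos hx hs0.le hs1
    -- Both exponents are nonpositive, where `exp` is 1-Lipschitz, so the logarithmic error passes
    -- on without loss.
    have hL : Real.log (tailProb n d) + (d * step n) ^ 2 / 2 ≤ 0 := by
      have := Real.log_le_log hpos hT'
      rw [Real.log_exp] at this
      linarith
    have hTe : tailProb n d = Real.exp (Real.log (tailProb n d) + (d * step n) ^ 2 / 2) *
        Real.exp (-(d * step n) ^ 2 / 2) := by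
      rw [← Real.exp_add, show Real.log (tailProb n d) + (d * step n) ^ 2 / 2 +
        -(d * step n) ^ 2 / 2 = Real.log (tailProb n d) by ring, Real.exp_log hpos]
    have b3 := (abs_exp_sub_exp_le hL hA).trans b1
    have hw := Real.exp_pos (-(d * step n) ^ 2 / 2)
    generalize Real.log (tailProb n d) + (d * step n) ^ 2 / 2 = ℓ at *
    rw [hTe, ← sub_mul, abs_mul, abs_of_pos hw]
    refine mul_le_mul_of_nonneg_right ?_ hw.le
    calc _ ≤ C₁ * (1 + d * step n) ^ K₁ * step n ^ 6 + C₂ * (1 + d * step n) ^ K₂ * step n ^ 6 :=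
          (abs_sub_le _ _ _).trans (add_le_add b3 b2)
      _ = (C₁ * (1 + d * step n) ^ K₁ + C₂ * (1 + d * step n) ^ K₂ + 0) * step n ^ 6 := by ring
      _ ≤ _ := by
          have p3 : 0 ≤ (1 + |expExpansion (d * step n) (step n)|) * (64 * (d * step n) ^ 6) := by
            positivity
          exact mul_le_mul_of_nonneg_right (by linarith) (by positivity)

open Polynomial in
theorem exists_abs_sum_tailProb_sub_le (p : ℝ[X]) :
    ∃ C : ℝ, ∀ n : ℕ, 1 ≤ n →
      |∑ d ∈ Finset.range (n + 1), p.eval (d * step n) * tailProb n d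
        - ∑ j ∈ Finset.range 6, step n ^ j * eulerMaclaurin (p * expCoeff j) (step n)| ≤
      C * step n ^ 5 := by
  obtain ⟨C₁, K₁, hC₁, h₁⟩ := exists_abs_tailProb_sub_le
  obtain ⟨C₂, K₂, hC₂, h₂⟩ := exists_abs_eval_le p
  choose C₃ h₃ using fun j => abs_tsum_polyGauss_sub_le (p * expCoeff j)
  have hC₃ : ∀ j, 0 ≤ C₃ j := fun j => by
    simpa using (abs_nonneg _).trans (h₃ j 1 one_pos le_rfl)
  refine ⟨C₂ * C₁ * ((K₂ + K₁).factorial * Real.exp 3) * 2 + ∑ j ∈ Finset.range 6, C₃ j,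
    fun n hn => ?_⟩
  have hs0 := step_pos hn
  have hs1 := step_le_one hn
  set h := step n with hh
  have hsum1 : HasSum (fun d : ℕ => p.eval (d * h) * tailProb n d)
      (∑ d ∈ Finset.range (n + 1), p.eval (d * h) * tailProb n d) := by
    -- `tailProb` vanishes beyond `n`, so the finite sum is a full series and can be compared
    -- termwise with the Gaussian one.
    refine hasSum_sum_of_ne_finset_zero fun d hd => ?_
    rw [tailProb_eq_zero, mul_zero]
    simp at hd
    omega
  have hsum2 : HasSum (fun d : ℕ => ∑ j ∈ Finset.range 6, h ^ j * polyGauss (p * expCoeff j) (d * h))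
      (∑ j ∈ Finset.range 6, h ^ j * ∑' d : ℕ, polyGauss (p * expCoeff j) (d * h)) :=
    hasSum_sum fun j _ => (summable_polyGauss _ hs0 hs1).hasSum.mul_left _
  have hterm : ∀ d : ℕ, |p.eval (d * h) * tailProb n d
      - ∑ j ∈ Finset.range 6, h ^ j * polyGauss (p * expCoeff j) (d * h)| ≤
      C₂ * C₁ * ((K₂ + K₁).factorial * Real.exp 3) * h ^ 6 * Real.exp (-(d * h)) := by
    intro d
    have hx : 0 ≤ d * h := by positivity
    have e : ∑ j ∈ Finset.range 6, h ^ j * polyGauss (p * expCoeff j) (d * h) =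
        p.eval (d * h) * (expExpansion (d * h) h * Real.exp (-(d * h) ^ 2 / 2)) := by
      rw [expExpansion, Finset.sum_mul, Finset.mul_sum]
      refine Finset.sum_congr rfl fun j _ => ?_
      rw [polyGauss, eval_mul]
      ring
    rw [e, ← mul_sub, abs_mul]
    calc _ ≤ (C₂ * (1 + d * h) ^ K₂) *
          (C₁ * (1 + d * h) ^ K₁ * h ^ 6 * Real.exp (-(d * h) ^ 2 / 2)) :=
          mul_le_mul (h₂ _ hx) (h₁ n d hn) (abs_nonneg _) (by positivity)
      _ = C₂ * C₁ * h ^ 6 * ((1 + d * h) ^ (K₂ + K₁) * Real.exp (-(d * h) ^ 2 / 2)) := by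
          rw [pow_add]
          ring
      _ ≤ C₂ * C₁ * h ^ 6 * ((K₂ + K₁).factorial * Real.exp 3 * Real.exp (-(d * h))) :=
          mul_le_mul_of_nonneg_left (pow_mul_exp_le _ hx) (by positivity)
      _ = _ := by ring
  have hlim := (hsum1.sub hsum2).tendsto_sum_nat.abs
  have hle := le_of_tendsto' hlim fun N => by
    calc _ ≤ ∑ d ∈ Finset.range N,
          C₂ * C₁ * ((K₂ + K₁).factorial * Real.exp 3) * h ^ 6 * Real.exp (-(d * h)) :=
          (Finset.abs_sum_le_sum_abs _ _).trans (Finset.sum_le_sum fun d _ => hterm d)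
      _ ≤ C₂ * C₁ * ((K₂ + K₁).factorial * Real.exp 3) * h ^ 6 * (2 / h) := by
          rw [← Finset.mul_sum]
          exact mul_le_mul_of_nonneg_left (sum_exp_neg_le hs0 hs1 N) (by positivity)
      _ = C₂ * C₁ * ((K₂ + K₁).factorial * Real.exp 3) * 2 * h ^ 5 := by
          field_simp
  have hEM : |∑ j ∈ Finset.range 6, h ^ j * ∑' d : ℕ, polyGauss (p * expCoeff j) (d * h)
      - ∑ j ∈ Finset.range 6, h ^ j * eulerMaclaurin (p * expCoeff j) h| ≤
      (∑ j ∈ Finset.range 6, C₃ j) * h ^ 5 := by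
    rw [← Finset.sum_sub_distrib, Finset.sum_mul]
    refine (Finset.abs_sum_le_sum_abs _ _).trans (Finset.sum_le_sum fun j _ => ?_)
    rw [← mul_sub, abs_mul, abs_of_nonneg (by positivity)]
    calc _ ≤ 1 * (C₃ j * h ^ 5) :=
          mul_le_mul (pow_le_one₀ hs0.le hs1) (h₃ j h hs0 hs1) (abs_nonneg _) zero_le_one
      _ = _ := one_mul _
  rw [add_mul]
  exact (abs_sub_le _ _ _).trans (add_le_add hle hEM)

end TailProb

/-! ### Explicit expansions of the two sums and of the moments. -/

section Moments

open Polynomial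

lemma eulerMaclaurin_add (p q : ℝ[X]) (h : ℝ) :
    eulerMaclaurin (p + q) h = eulerMaclaurin p h + eulerMaclaurin q h := by
  simp only [eulerMaclaurin, halfMoment_add, coeff_add]
  ring

lemma eulerMaclaurin_C_mul (c : ℝ) (p : ℝ[X]) (h : ℝ) :
    eulerMaclaurin (C c * p) h = c * eulerMaclaurin p h := by
  simp only [eulerMaclaurin, halfMoment_C_mul, coeff_C_mul]
  ring

/-- The recursion for the half-line moments of the Gaussian. -/
noncomputable def gaussMoment : ℕ → ℝ
  | 0 => √(Real.pi / 2)
  | 1 => 1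
  | k + 2 => (k + 1) * gaussMoment k

lemma halfMoment_X_pow : ∀ k : ℕ, halfMoment (X ^ k) = gaussMoment k
  | 0 => by rw [pow_zero, halfMoment_one, gaussMoment]
  | 1 => by rw [pow_one, halfMoment_X, gaussMoment]
  | k + 2 => by rw [halfMoment_X_pow_add_two, halfMoment_X_pow k, gaussMoment]

lemma eulerMaclaurin_X_pow (k : ℕ) (h : ℝ) :
    eulerMaclaurin (X ^ k) h = gaussMoment k / h + (if k = 0 then 1 / 2 else 0)
      - (if k = 1 then h / 12 + h ^ 3 / 240 else 0) + (if k = 3 then h ^ 3 / 120 else 0) := by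
  rw [eulerMaclaurin, halfMoment_X_pow]
  simp only [coeff_X_pow]
  by_cases h0 : k = 0
  · subst h0
    norm_num
  by_cases h1 : k = 1
  · subst h1
    norm_num
    ring
  by_cases h3 : k = 3
  · subst h3
    norm_num
    ring
  simp [h0, h1, h3, Ne.symm h0, Ne.symm h1, Ne.symm h3]

/-- The terms in `h ^ 6` and `h ^ 8` are products of higher coefficients with boundary terms; they
lie below the accuracy and are kept only to make the identity exact. -/
lemma sum_eulerMaclaurin_expCoeff {h : ℝ} (hh : h ≠ 0) :
    ∑ j ∈ Finset.range 6, h ^ j * eulerMaclaurin (1 * expCoeff j) h =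
      √(Real.pi / 2) / h - 2 / 3 + 11 / 24 * √(Real.pi / 2) * h + 4 / 135 * h ^ 2
        - 71 / 1152 * √(Real.pi / 2) * h ^ 3 - 8 / 2835 * h ^ 4
        - h ^ 6 / 1152 + h ^ 8 / 3840 := by
  have e0 : (1 : ℝ[X]) = X ^ 0 := (pow_zero X).symm
  simp only [Finset.sum_range_succ, Finset.sum_range_zero, one_mul, expCoeff, eulerMaclaurin_add,
    eulerMaclaurin_C_mul]
  rw [e0]
  simp only [eulerMaclaurin_X_pow, gaussMoment]
  norm_num
  field_simp
  ring

lemma sum_eulerMaclaurin_X_mul_expCoeff {h : ℝ} (hh : h ≠ 0) :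
    ∑ j ∈ Finset.range 6, h ^ j * eulerMaclaurin (X * expCoeff j) h =
      1 / h - 3 / 2 * √(Real.pi / 2) + 5 / 3 * h - 29 / 48 * √(Real.pi / 2) * h ^ 2
        + 205 / 2304 * √(Real.pi / 2) * h ^ 4 - h ^ 5 / 960 + h ^ 7 / 2880 := by
  have e : ∀ (c : ℝ) (k : ℕ), (X : ℝ[X]) * (C c * X ^ k) = C c * X ^ (k + 1) := by
    intro c k
    rw [pow_succ', mul_left_comm]
  have e1 : (X : ℝ[X]) * 1 = X ^ 1 := by simp
  simp only [Finset.sum_range_succ, Finset.sum_range_zero, expCoeff, mul_add, e, e1,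
    eulerMaclaurin_add, eulerMaclaurin_C_mul]
  simp only [eulerMaclaurin_X_pow, gaussMoment]
  norm_num
  field_simp
  ring

theorem exists_sum_tailProb_eq :
    ∃ C : ℝ, ∃ e : ℕ → ℝ, ∀ n : ℕ, 1 ≤ n → |e n| ≤ C ∧
      ∑ d ∈ Finset.range n, tailProb n (d + 1) =
        √(Real.pi / 2) / step n - 5 / 3 + 11 / 24 * √(Real.pi / 2) * step n
          + 4 / 135 * step n ^ 2 - 71 / 1152 * √(Real.pi / 2) * step n ^ 3
          - 8 / 2835 * step n ^ 4 + e n * step n ^ 5 := by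
  obtain ⟨C, hC⟩ := exists_abs_sum_tailProb_sub_le 1
  refine ⟨C + 1, fun n => (∑ d ∈ Finset.range n, tailProb n (d + 1) -
    (√(Real.pi / 2) / step n - 5 / 3 + 11 / 24 * √(Real.pi / 2) * step n
          + 4 / 135 * step n ^ 2 - 71 / 1152 * √(Real.pi / 2) * step n ^ 3
          - 8 / 2835 * step n ^ 4)) / step n ^ 5, fun n hn => ?_⟩
  have h0 := step_pos hn
  have h1 := step_le_one hn
  have hb := hC n hn
  refine ⟨?_, by rw [div_mul_cancel₀ _ (pow_pos h0 5).ne', add_sub_cancel]⟩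
  -- Dropping the `d = 0` term, which is `1`, turns `-2/3` into `-5/3`.
  rw [sum_eulerMaclaurin_expCoeff h0.ne', Finset.sum_range_succ'] at hb
  simp only [eval_one, one_mul, tailProb_zero] at hb
  rw [abs_div, abs_of_pos (pow_pos h0 5), div_le_iff₀ (pow_pos h0 5)]
  have h6 : step n ^ 6 ≤ step n ^ 5 := pow_le_pow_of_le_one h0.le h1 (by norm_num)
  have h8 : step n ^ 8 ≤ step n ^ 5 := pow_le_pow_of_le_one h0.le h1 (by norm_num)
  have p6 := pow_pos h0 6
  have p8 := pow_pos h0 8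
  rw [abs_le] at hb ⊢
  constructor <;> linarith [hb.1, hb.2]

theorem exists_sum_mul_tailProb_eq :
    ∃ C : ℝ, ∃ e : ℕ → ℝ, ∀ n : ℕ, 1 ≤ n → |e n| ≤ C ∧
      ∑ d ∈ Finset.range n, ((d + 1 : ℕ) * step n) * tailProb n (d + 1) =
        1 / step n - 3 / 2 * √(Real.pi / 2) + 5 / 3 * step n
          - 29 / 48 * √(Real.pi / 2) * step n ^ 2 + 205 / 2304 * √(Real.pi / 2) * step n ^ 4
          + e n * step n ^ 5 := by
  obtain ⟨C, hC⟩ := exists_abs_sum_tailProb_sub_le X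
  refine ⟨C + 1, fun n =>
    (∑ d ∈ Finset.range n, ((d + 1 : ℕ) * step n) * tailProb n (d + 1) -
    (1 / step n - 3 / 2 * √(Real.pi / 2) + 5 / 3 * step n
          - 29 / 48 * √(Real.pi / 2) * step n ^ 2 + 205 / 2304 * √(Real.pi / 2) * step n ^ 4))
      / step n ^ 5, fun n hn => ?_⟩
  have h0 := step_pos hn
  have h1 := step_le_one hn
  have hb := hC n hn
  refine ⟨?_, by rw [div_mul_cancel₀ _ (pow_pos h0 5).ne', add_sub_cancel]⟩
  rw [sum_eulerMaclaurin_X_mul_expCoeff h0.ne', Finset.sum_range_succ'] at hb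
  simp only [eval_X, Nat.cast_zero, zero_mul, add_zero] at hb
  rw [abs_div, abs_of_pos (pow_pos h0 5), div_le_iff₀ (pow_pos h0 5)]
  have h7 : step n ^ 7 ≤ step n ^ 5 := pow_le_pow_of_le_one h0.le h1 (by norm_num)
  have p5 := pow_pos h0 5
  have p7 := pow_pos h0 7
  rw [abs_le] at hb ⊢
  constructor <;> linarith [hb.1, hb.2]

/-- Writes the weight `2 d + 1` as `2 (d + 1) - 1`, so that the two expanded sums appear. -/
lemma integral_normalizedPasses_sq_eq {n : ℕ} {x : Fin n → ℝ} (hx : Function.Injective x)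
    (hn : 1 ≤ n) :
    ∫ σ, normalizedPasses x σ ^ 2 ∂(uniformPerm n) =
      2 * step n * ∑ d ∈ Finset.range n, ((d + 1 : ℕ) * step n) * tailProb n (d + 1)
        - step n ^ 2 * ∑ d ∈ Finset.range n, tailProb n (d + 1) := by
  rw [integral_normalizedPasses_sq hx hn, div_eq_mul_one_div, ← step_sq, Finset.sum_mul,
    Finset.mul_sum, Finset.mul_sum, ← Finset.sum_sub_distrib]
  refine Finset.sum_congr rfl fun d _ => ?_
  push_cast
  ring

lemma integral_normalizedPasses_eq {n : ℕ} {x : Fin n → ℝ} (hx : Function.Injective x)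
    (hn : 1 ≤ n) :
    ∫ σ, normalizedPasses x σ ∂(uniformPerm n) =
      step n * ∑ d ∈ Finset.range n, tailProb n (d + 1) := by
  rw [integral_normalizedPasses hx hn, step, div_eq_inv_mul]

lemma sqrt_pi_div (n : ℕ) : √(Real.pi / (2 * (n : ℝ))) = √(Real.pi / 2) * step n := by
  rw [← div_div, Real.sqrt_div' _ (Nat.cast_nonneg n), step, div_eq_mul_inv]

lemma step_pow_five (n : ℕ) : (n : ℝ) ^ (-(5 / 2) : ℝ) = step n ^ 5 := by
  rw [step, Real.sqrt_eq_rpow, ← Real.rpow_neg (Nat.cast_nonneg n), ← Real.rpow_natCast,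
    ← Real.rpow_mul (Nat.cast_nonneg n)]
  norm_num

lemma tendsto_step : Tendsto step atTop (nhds 0) :=
  tendsto_inv_atTop_zero.comp (Real.tendsto_sqrt_atTop.comp tendsto_natCast_atTop_atTop)

/-- A sequence of the form `κ h ^ 5 + h ^ 6 G(h, a, b)` with `κ ≠ 0`, continuous `G` and bounded
`a`, `b`, where `h = n ^ (-1 / 2)`, is of exact order `h ^ 5`. -/
lemma isTheta_step_pow_five {f a b : ℕ → ℝ} {A B κ : ℝ} (hκ : κ ≠ 0) (G : ℝ × ℝ × ℝ → ℝ)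
    (hG : Continuous G) (ha : ∀ n, 1 ≤ n → |a n| ≤ A) (hb : ∀ n, 1 ≤ n → |b n| ≤ B)
    (hf : ∀ n, 1 ≤ n → f n = κ * step n ^ 5 + step n ^ 6 * G (step n, a n, b n)) :
    f =Θ[atTop] fun n : ℕ => (n : ℝ) ^ (-(5 / 2) : ℝ) := by
  simp_rw [step_pow_five]
  obtain ⟨M, hM⟩ := (isCompact_Icc.prod (isCompact_Icc.prod isCompact_Icc) :
    IsCompact (Set.Icc (0 : ℝ) 1 ×ˢ Set.Icc (-A) A ×ˢ Set.Icc (-B) B)).exists_bound_of_continuousOn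
      hG.continuousOn
  have hO : (fun n => f n - κ * step n ^ 5) =O[atTop] fun n => step n ^ 6 := by
    refine IsBigO.of_bound M ?_
    filter_upwards [eventually_ge_atTop 1] with n hn
    rw [hf n hn, add_sub_cancel_left, norm_mul, mul_comm]
    gcongr
    exact hM _ ⟨⟨(step_pos hn).le, step_le_one hn⟩, abs_le.1 (ha n hn), abs_le.1 (hb n hn)⟩
  have ho : (fun n => step n ^ 6) =o[atTop] fun n => κ * step n ^ 5 := by
    rw [isLittleO_const_mul_right_iff hκ]
    have := (isLittleO_one_iff ℝ).2 tendsto_step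
    have h2 := this.mul_isBigO (isBigO_refl (fun n => step n ^ 5) atTop)
    simpa only [one_mul, ← pow_succ'] using h2
  have heq : f ~[atTop] fun n => κ * step n ^ 5 := hO.trans_isLittleO ho
  exact heq.isTheta.trans ((isTheta_refl _ _).const_mul_left hκ)

end Moments

end BubbleSort

/-! ### Comparison of coefficients up to `h^5`. -/

theorem mainTheorem5 (x : (n : ℕ) → Fin n → ℝ) (hx : ∀ n, Function.Injective (x n)) :
    ((fun n : ℕ =>
        (∫ σ, (BubbleSort.normalizedPasses (x n) σ) ^ 2 ∂(BubbleSort.uniformPerm n))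
          - (2 - 4 * √(Real.pi / (2 * (n : ℝ))) + 5 / (n : ℝ)
              - 5 / (3 * (n : ℝ)) * √(Real.pi / (2 * (n : ℝ)))
              - 4 / (135 * (n : ℝ) ^ 2)))
      =Θ[atTop] (fun n : ℕ => (n : ℝ) ^ (-(5 / 2) : ℝ)))
    ∧
    ((fun n : ℕ =>
        variance (BubbleSort.normalizedPasses (x n)) (BubbleSort.uniformPerm n)
          - ((4 - Real.pi) / 2 - 2 / 3 * √(Real.pi / (2 * (n : ℝ)))
              + (160 - 33 * Real.pi) / (72 * (n : ℝ))
              - 107 / (540 * (n : ℝ)) * √(Real.pi / (2 * (n : ℝ)))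
              - (1125 * Real.pi - 1792) / (25920 * (n : ℝ) ^ 2)))
      =Θ[atTop] (fun n : ℕ => (n : ℝ) ^ (-(5 / 2) : ℝ))) := by
  obtain ⟨A, a, ha⟩ := BubbleSort.exists_sum_tailProb_eq
  obtain ⟨B, b, hb⟩ := BubbleSort.exists_sum_mul_tailProb_eq
  have hs : √(Real.pi / 2) ≠ 0 := by
    have := Real.pi_pos
    positivity
  have hπ : Real.pi = 2 * √(Real.pi / 2) ^ 2 := by
    rw [Real.sq_sqrt (by positivity)]
    ring
  have hinv : ∀ n : ℕ, 1 ≤ n → (n : ℝ) = 1 / BubbleSort.step n ^ 2 := fun n _ => by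
    rw [BubbleSort.step_sq, one_div_one_div]
  constructor
  -- The `h^5` coefficient is `2 · 205/2304 + 71/1152 = 23/96` times `√(π/2)`.
  · refine BubbleSort.isTheta_step_pow_five (κ := 23 / 96 * √(Real.pi / 2))
      (mul_ne_zero (by norm_num) hs) (fun z => 2 * z.2.2 - z.1 * z.2.1 + 8 / 2835) (by fun_prop)
      (fun n hn => (ha n hn).1) (fun n hn => (hb n hn).1) fun n hn => ?_
    have h0 := (BubbleSort.step_pos hn).ne'
    rw [BubbleSort.integral_normalizedPasses_sq_eq (hx n) hn, (ha n hn).2, (hb n hn).2,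
      BubbleSort.sqrt_pi_div, hinv n hn]
    field_simp
    ring
  · let s := √(Real.pi / 2)
    -- From `23/96` subtract the `h^5` coefficient of the squared mean, `2 (-8/2835 + 5/3 · 71/1152
    -- + 11/24 · 4/135)`, all times `s`. The rest of the square, from `h^6` on, goes into `G`.
    refine BubbleSort.isTheta_step_pow_five (κ := 2291 / 181440 * s)
      (mul_ne_zero (by norm_num) hs)
      (fun z => 2 * z.2.2 - z.1 * z.2.1 + 8 / 2835
        - (2 * z.2.1 * (s - 5 / 3 * z.1 + 11 / 24 * s * z.1 ^ 2 + 4 / 135 * z.1 ^ 3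
            - 71 / 1152 * s * z.1 ^ 4 - 8 / 2835 * z.1 ^ 5) + z.1 ^ 6 * z.2.1 ^ 2
          + (2 * (5 / 3) * (8 / 2835) - 2 * (11 / 24 * s) * (71 / 1152 * s) + (4 / 135) ^ 2)
          + z.1 * (-2 * (11 / 24 * s) * (8 / 2835) - 2 * (4 / 135) * (71 / 1152 * s))
          + z.1 ^ 2 * (-2 * (4 / 135) * (8 / 2835) + (71 / 1152 * s) ^ 2)
          + z.1 ^ 3 * (2 * (71 / 1152 * s) * (8 / 2835)) + z.1 ^ 4 * (8 / 2835) ^ 2)) (by fun_prop)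
      (fun n hn => (ha n hn).1) (fun n hn => (hb n hn).1) fun n hn => ?_
    have h0 := (BubbleSort.step_pos hn).ne'
    rw [BubbleSort.variance_normalizedPasses, BubbleSort.integral_normalizedPasses_eq (hx n) hn,
      BubbleSort.integral_normalizedPasses_sq_eq (hx n) hn, (ha n hn).2, (hb n hn).2,
      BubbleSort.sqrt_pi_div, hinv n hn]
    change _ = _ * s * _ + _
    have hs' : √(Real.pi / 2) = s := rfl
    rw [hs'] at hπ ⊢
    clear_value s
    rw [hπ]
    field_simp
    ring
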